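/- **Setting.** Let $\Lambda$ be a finite lattice (a finite graph, with graph distance $d$ and $d=\infty$ between different components) with a finite-dimensional Hilbert space at every site. Let $\Lambda'=\Lambda\sqcup E$ be an extended lattice that also contains ancilla sites $E$ and restricts to $\Lambda$ as an induced subgraph. Let $|\psi\rangle=U|0\cdots0\rangle$, where $U$ is a circuit of depth $D$ on $\Lambda'$ made of nearest-neighbour unitary gates, and let $\rho_\Lambda=\mathrm{Tr}_E|\psi\rangle\langle\psi|$. Write $v(s)=\{u: d(u,v)\le s\}$ for the disc of radius $s$ at $v$, $A(s)=\bigcup_{v\in A}v(s)$ for thickenings, $\langle O\rangle=\mathrm{Tr}[\rho_\Lambda O]$, and $D_p(\rho,\sigma)=\sqrt{1-\|\sqrt\rho\sqrt\sigma\|_1^2}$ for the purified distance. For $\delta\in[0,1]$ and integers $r,t\ge 0$, an operator $P$ on $\Lambda$ is *$(\delta,r,t)$-approximately locally invisible* for $\rho_\Lambda$ if for every disc $A\subseteq\Lambda$ of radius at most $r$, every $B=A(t')$ with $t'\ge t$, and every state $\rho'_\Lambda$ with $\rho'_B=\rho_B$, $$D_p\!\left(\rho_A,\ \frac{\mathrm{Tr}_{A^c}[P\rho'_\Lambda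 P^\dagger]}{\mathrm{Tr}[P\rho'_\Lambda P^\dagger]}\right)\le\delta .$$ Let $M\subseteq\Lambda$ and $M^c=\Lambda\setminus M$. For decompositions $P=\sum_jP_M^j\otimes P_{M^c}^j$ and $Q=\sum_kQ_M^k\otimes Q_{M^c}^k$, put $$P\infty Q=\sum_{j,k}P_{M^c}^jQ_{M^c}^k\otimes Q_M^kP_M^j,\qquad \alpha_P=\sum_j\|P_M^j\|\,\|P_{M^c}^j\|,\qquad \alpha_Q=\sum_k\|Q_M^k\|\,\|Q_{M^c}^k\| .$$ **Theorem.** Let $P$ and $Q$ be unitaries on $\Lambda$, implemented by nearest-neighbour circuits of depth at most $t$, both $(\delta,r,t)$-approximately locally invisible for $\rho_\Lambda$, and supported on regions $p$ and $q$ (for instance two annuli that meet at two well-separated points). Suppose that $p\cap q\subseteq X_1\cup X_2$ with $X_1\subseteq M$ and $X_2\subseteq M^c$. Assume: 1. $T_1,\dots,T_{k_P}$ are discs in $\Lambda$ of radius at most $r-D$ that cover $p(D)$; 2. $S_1,\dots,S_m$ are discs in $\Lambda$ of radius at most $r-D$ that cover $\bigcup_jT_j(t+2D)$ (and hence $p(t+3D)$);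 3. for each of these discs, the concentric disc in $\Lambda'$ whose radius is larger by $t+3D$ lies in $\Lambda$; 4. for every $i$, either $S_i(D)\cap q\subseteq M$, or $S_i(D)\cap q\subseteq M^c$ and $S_i(D)$ meets $X_2$; 5. for some $d_{\rm sep}$, every site of $p\cap M$ is at distance at least $d_{\rm sep}$ from every site of $X_2$, and $d_{\rm sep}>2\,(\mathrm{rad}(S_i)+t+3D)$ for every $i$; 6. at most $k_Q$ of the discs $S_i(D)$ meet $X_2$. Then, for all decompositions of $P$ and $Q$ as above, $$\bigl|\langle P\infty Q\rangle-\langle P\rangle\langle Q\rangle\bigr|\le 2\delta\,(\alpha_Pk_Q+\alpha_Qk_P).$$ -/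

import Mathlib

open scoped Matrix ComplexOrder

noncomputable section

namespace TwistWitness

/-! ### Finite-dimensional many-body systems

`V` is the finite set of sites and `d v` the dimension of the Hilbert space at the site `v`.  Operators
are matrices in the product basis. -/

section Systems

variable {V : Type*}

/-- Product-basis labels of `⨂ v, ℂ ^ (d v)`. -/
abbrev Conf (d : V → ℕ) : Type _ := ∀ v, Fin (d v)

/-- Operators on `⨂ v, ℂ ^ (d v)`. -/
abbrev Op (d : V → ℕ) : Type _ := Matrix (Conf d) (Conf d) ℂ

/-- The local dimensions of the subsystem on the sites of `A`. -/
abbrev sub (d : V → ℕ) (A : Set V) : A → ℕ := fun v => d v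

/-- The basis label on `V` that is `a` on `A` and `c` off `A`. -/
def glue {d : V → ℕ} (A : Set V) (a : Conf (sub d A)) (c : Conf (sub d Aᶜ)) : Conf d :=
  open Classical in fun v => if h : v ∈ A then a ⟨v, h⟩ else c ⟨v, h⟩

/-- The operator `O ⊗ 1` on all sites, for an operator `O` on the subsystem `A`. -/
def ampliate {d : V → ℕ} (A : Set V) (O : Op (sub d A)) : Op d :=
  open Classical in
  Matrix.of fun x y => if ∀ v ∉ A, x v = y v then O (fun v => x v) (fun v => y v) else 0

/-- `O` is supported on `A`: it has the form `O_A ⊗ 1`. -/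
def SupportedOn {d : V → ℕ} (A : Set V) (O : Op d) : Prop :=
  ∃ O' : Op (sub d A), O = ampliate A O'

variable [Fintype V] [DecidableEq V]

/-- The marginal `Tr_{Aᶜ} ρ` on the subsystem `A`. -/
def marginal {d : V → ℕ} (A : Set V) (ρ : Op d) : Op (sub d A) :=
  open Classical in
  Matrix.of fun a b => ∑ c : Conf (sub d Aᶜ), ρ (glue A a c) (glue A b c)

/-- The operator norm with respect to the Euclidean (Hilbert space) norm. -/
def opNorm {d : V → ℕ} (O : Op d) : ℝ := ‖Matrix.toEuclideanCLM (n := Conf d) (𝕜 := ℂ) O‖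

/-- The basis vector `|0 ⋯ 0⟩`. -/
def zeroKet (d : V → ℕ) [∀ v, NeZero (d v)] : Conf d → ℂ := Pi.single (fun _ => 0) 1

end Systems

/-! ### States and the purified distance -/

section States

variable {n : Type*} [Fintype n] [DecidableEq n]

/-- Density matrices. -/
def IsState (ρ : Matrix n n ℂ) : Prop := ρ.PosSemidef ∧ ρ.trace = 1

/-- The Schatten 1-norm `Tr √(Aᴴ A)`. -/
def traceNorm (A : Matrix n n ℂ) : ℝ := (cfc Real.sqrt (Aᴴ * A)).trace.re

/-- The fidelity `‖√ρ √σ‖₁²`. -/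
def fidelity (ρ σ : Matrix n n ℂ) : ℝ :=
  traceNorm (cfc Real.sqrt ρ * cfc Real.sqrt σ) ^ 2

/-- The purified distance `√(1 - F(ρ, σ))`. -/
def purifiedDistance (ρ σ : Matrix n n ℂ) : ℝ := Real.sqrt (1 - fidelity ρ σ)

end States

/-! ### Lattice geometry and local circuits -/

section Geometry

variable {V : Type*}

/-- The disc of radius `r` at `v`, in the graph distance (which is `⊤` between different components). -/
def disc (G : SimpleGraph V) (v : V) (r : ℕ) : Set V := {u | G.edist v u ≤ r}

/-- The thickening `A(r)`, the union of the discs of radius `r` at the sites of `A`. -/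
def thicken (G : SimpleGraph V) (A : Set V) (r : ℕ) : Set V := {u | ∃ v ∈ A, u ∈ disc G v r}

variable [Fintype V] [DecidableEq V]

/-- One layer of a nearest-neighbour circuit: a product of unitary gates with pairwise disjoint
supports, each acting on a single site or on the two ends of an edge. -/
def IsLayer (G : SimpleGraph V) {d : V → ℕ} (U : Op d) : Prop :=
  ∃ gates : List (Set V × Op d),
    (∀ g ∈ gates, (∃ u v, (u = v ∨ G.Adj u v) ∧ g.1 = {u, v}) ∧
      SupportedOn g.1 g.2 ∧ g.2 ∈ Matrix.unitaryGroup (Conf d) ℂ) ∧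
    gates.Pairwise (fun g h => Disjoint g.1 h.1) ∧
    U = (gates.map Prod.snd).prod

/-- `U` is implemented by a nearest-neighbour circuit of depth (at most) `D`; layers may be trivial. -/
def IsLocalCircuit (G : SimpleGraph V) {d : V → ℕ} (D : ℕ) (U : Op d) : Prop :=
  ∃ layers : List (Op d), layers.length = D ∧ (∀ L ∈ layers, IsLayer G L) ∧ U = layers.prod

/-- `P` is `(δ, r, t)`-approximately locally invisible with respect to the state `ρ`: for every disc `A`
of radius at most `r`, every `B = A(t')` with `t' ≥ t`, and every state `ρ'` with the same marginal on
`B` as `ρ`, the normalized marginal of `P ρ' Pᴴ` on `A` is `δ`-close to that of `ρ`. -/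
def IsApproxLocallyInvisible (G : SimpleGraph V) {d : V → ℕ} (δ : ℝ) (r t : ℕ) (ρ P : Op d) : Prop :=
  open Classical in
  ∀ (v : V) (s t' : ℕ), s ≤ r → t ≤ t' → ∀ ρ' : Op d, IsState ρ' →
    marginal (thicken G (disc G v s) t') ρ' = marginal (thicken G (disc G v s) t') ρ →
    purifiedDistance (marginal (disc G v s) ρ)
      ((P * ρ' * Pᴴ).trace⁻¹ • marginal (disc G v s) (P * ρ' * Pᴴ)) ≤ δ

end Geometry

/-! ### The twist product -/

section Twist

variable {V : Type*} [Fintype V] [DecidableEq V]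

/-- A decomposition `P = ∑ j, P_M^j ⊗ P_{Mᶜ}^j` across the cut `M ∣ Mᶜ`; the tensor factors are written
as operators on the whole system. -/
structure CutDecomposition {d : V → ℕ} (M : Set V) (P : Op d) where
  num : ℕ
  inner : Fin num → Op d
  outer : Fin num → Op d
  inner_supported : ∀ j, SupportedOn M (inner j)
  outer_supported : ∀ j, SupportedOn Mᶜ (outer j)
  sum_eq : ∑ j, inner j * outer j = P

variable {d : V → ℕ} {M : Set V} {P Q : Op d}

/-- The twist product `P ∞ Q = ∑ j k, P_{Mᶜ}^j Q_{Mᶜ}^k ⊗ Q_M^k P_M^j`. -/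
def CutDecomposition.twist (p : CutDecomposition M P) (q : CutDecomposition M Q) : Op d :=
  ∑ j, ∑ k, (p.outer j * q.outer k) * (q.inner k * p.inner j)

/-- `α_P = ∑ j, ‖P_M^j‖ ‖P_{Mᶜ}^j‖`. -/
def CutDecomposition.alpha (p : CutDecomposition M P) : ℝ :=
  ∑ j, opNorm (p.inner j) * opNorm (p.outer j)

end Twist

/-! ### The lattice with purifying ancillas

The extended system lives on `Λ ⊕ E`, where `E` is the set of ancilla sites. -/

section Purification

variable {Λ E : Type*} [Fintype Λ] [DecidableEq Λ] [Fintype E] [DecidableEq E]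

/-- The local dimensions on the lattice `Λ`. -/
abbrev onLattice (d : Λ ⊕ E → ℕ) : Λ → ℕ := fun v => d (Sum.inl v)

/-- The basis label on `Λ ⊕ E` formed from labels on `Λ` and on `E`. -/
def pairConf {d : Λ ⊕ E → ℕ} (x : Conf (onLattice d)) (e : Conf fun w : E => d (Sum.inr w)) : Conf d
  | Sum.inl v => x v
  | Sum.inr w => e w

/-- The reduced state `Tr_E |ψ⟩⟨ψ|` on the lattice `Λ`. -/
def latticeState {d : Λ ⊕ E → ℕ} (ψ : Conf d → ℂ) : Op (onLattice d) :=
  Matrix.of fun x y => ∑ e : Conf fun w : E => d (Sum.inr w),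
    ψ (pairConf x e) * star (ψ (pairConf y e))

/-- The expectation value `⟨ψ| O ⊗ 1_E |ψ⟩ = Tr (Tr_E |ψ⟩⟨ψ| O)` of an operator `O` on the lattice. -/
def expectation {d : Λ ⊕ E → ℕ} (ψ : Conf d → ℂ) (O : Op (onLattice d)) : ℂ :=
  (latticeState ψ * O).trace

end Purification

end TwistWitness

end

/-!
Conjugating by the circuit `U` turns the state into the product state `|0 ⋯ 0⟩` and every lattice
observable `O` into `Uᴴ (O ⊗ 1) U` (`heisenberg`), whose support is larger by at most `D`
(`IsLocalCircuit.supportedOn_conj`).  From now on all operators are in this picture.  The product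
state has the projectors `Π_A` onto `|0⟩` on the sites of `A` (`vacProj`); they satisfy
`Π_A Y Π_A = ⟨Y⟩ Π_A` for `Y` supported on `A`, so that the state has no correlations.

For a disc `A` away from the ancillas, `Π_A` comes from a lattice observable on a disc larger by `D`.
If `K` acts far from `A`, the normalized state `K |0 ⋯ 0⟩` agrees with `|0 ⋯ 0⟩` around `A`, and local
invisibility of `Q` bounds the fidelity from below, hence also the weight of `Q K |0 ⋯ 0⟩` in `Π_A`:
`‖(1 - Π_A) Q K |0 ⋯ 0⟩‖ ≤ δ ‖K |0 ⋯ 0⟩‖` (`fidelity_le_of_projection`,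
`IsApproxLocallyInvisible.vacNorm_le`).

A decomposition of `P` can be restricted to the support of `P` without changing the twist product or
increasing `α_P` (`CutDecomposition.exists_restrict`), and the twist product is both
`∑ j, P_{Mᶜ}^j Q P_M^j` and `∑ k, Q_M^k P Q_{Mᶜ}^k`.  Let `R` be the union of the discs `S_i` that reach
`X₂` and meet the support of `Q` only outside `M`.  As `P_M^j` acts far from `R`, the projector
`Π_R` can be inserted to the left of `Q` in the first form, at the cost `δ α_P k_Q`.  It commutes with
`P_M^j` and with `Q_M^k`, so the result is `∑ k, Q_M^k P Π_R Q_{Mᶜ}^k` (`norm_twist_sub_le`).  Off `R`, the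
operators `Q_{Mᶜ}^k` do not touch the discs `S_i`, so `Π_R Q_{Mᶜ}^k |0 ⋯ 0⟩` is `|0⟩` on the whole light
cone of `P`.  There local invisibility of `P` on the discs `T_j` says that `P` acts as the scalar `⟨P⟩`, up to
`δ k_P`, and `∑ k, Q_M^k Π_R Q_{Mᶜ}^k = Π_R Q` has the expectation value `⟨Q⟩`.
-/

noncomputable section

namespace TwistWitness

/-! ### The fidelity with a state inside a projector -/

section Fidelity

variable {n : Type*} [Fintype n]

lemma trace_conjTranspose_mul_self_re (A : Matrix n n ℂ) :
    (Aᴴ * A).trace.re = ∑ i, ∑ j, ‖A j i‖ ^ 2 := by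
  simp only [Matrix.trace, Matrix.diag, Matrix.mul_apply, Matrix.conjTranspose_apply, Complex.re_sum]
  refine Finset.sum_congr rfl fun i _ => Finset.sum_congr rfl fun j _ => ?_
  rw [Complex.star_def, ← Complex.normSq_eq_conj_mul_self, Complex.ofReal_re, Complex.normSq_eq_norm_sq]

lemma trace_conjTranspose_mul_self_re_nonneg (A : Matrix n n ℂ) : 0 ≤ (Aᴴ * A).trace.re := by
  rw [trace_conjTranspose_mul_self_re]; positivity

/-- The Cauchy–Schwarz inequality for the Hilbert–Schmidt inner product. -/
lemma norm_trace_mul_sq_le (A B : Matrix n n ℂ) :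
    ‖(A * B).trace‖ ^ 2 ≤ (Aᴴ * A).trace.re * (Bᴴ * B).trace.re := by
  have h1 : ‖(A * B).trace‖ ≤ ∑ x : n × n, ‖A x.1 x.2‖ * ‖B x.2 x.1‖ := by
    simp only [Matrix.trace, Matrix.diag, Matrix.mul_apply, Fintype.sum_prod_type]
    refine (norm_sum_le _ _).trans (Finset.sum_le_sum fun i _ => (norm_sum_le _ _).trans ?_)
    exact Finset.sum_le_sum fun j _ => (norm_mul _ _).le
  calc ‖(A * B).trace‖ ^ 2 ≤ (∑ x : n × n, ‖A x.1 x.2‖ * ‖B x.2 x.1‖) ^ 2 := by gcongr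
    _ ≤ (∑ x : n × n, ‖A x.1 x.2‖ ^ 2) * ∑ x : n × n, ‖B x.2 x.1‖ ^ 2 :=
      Finset.sum_mul_sq_le_sq_mul_sq _ _ _
    _ = _ := by
      rw [trace_conjTranspose_mul_self_re, trace_conjTranspose_mul_self_re, Fintype.sum_prod_type,
        Fintype.sum_prod_type, Finset.sum_comm]

variable [DecidableEq n]

/-- The Hölder inequality `‖A B‖₁ ≤ ‖A‖₂ ‖B‖₂`. -/
lemma traceNorm_mul_sq_le (A B : Matrix n n ℂ) :
    traceNorm (A * B) ^ 2 ≤ (Aᴴ * A).trace.re * (Bᴴ * B).trace.re := by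
  set X := A * B with hX
  set H := Xᴴ * X with hH
  have hHpsd : H.PosSemidef := Matrix.posSemidef_conjTranspose_mul_self X
  have hspec : ∀ x ∈ spectrum ℝ H, 0 ≤ x := fun x hx => by
    rw [hHpsd.isHermitian.spectrum_real_eq_range_eigenvalues] at hx
    obtain ⟨i, rfl⟩ := hx
    exact hHpsd.eigenvalues_nonneg i
  have hfin : ∀ f : ℝ → ℝ, ContinuousOn f (spectrum ℝ H) := fun f => by
    have : (spectrum ℝ H).Finite := by
      rw [hHpsd.isHermitian.spectrum_real_eq_range_eigenvalues]; exact Set.finite_range _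
    exact this.continuousOn f
  have hHs : IsSelfAdjoint H := hHpsd.isHermitian
  -- `K` is the inverse of `√H` on the range of `H` and zero on its kernel, so that `W = K Xᴴ` is
  -- the adjoint of the partial isometry in the polar decomposition of `X`.
  set K : Matrix n n ℂ := cfc (fun x : ℝ => (Real.sqrt x)⁻¹) H with hK
  have hKh : Kᴴ = K := (cfc_predicate (fun x : ℝ => (Real.sqrt x)⁻¹) H : IsSelfAdjoint K)
  have hid : cfc (fun x : ℝ => x) H = H := cfc_id' ℝ H
  have hKH : K * H = cfc Real.sqrt H := by
    have : K * H = K * cfc (fun x : ℝ => x) H := by rw [hid]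
    rw [this, hK, ← cfc_mul _ _ H (hfin _) (hfin _)]
    refine cfc_congr fun x hx => ?_
    have := hspec x hx
    rcases this.eq_or_lt with h | h
    · simp [← h]
    · have := Real.sqrt_pos.2 h
      field_simp
      exact (Real.sq_sqrt h.le).symm
  have hKHK : K * (K * H) * K * K = K * K := by
    rw [hKH, hK, ← cfc_mul _ _ H (hfin _) (hfin _), ← cfc_mul _ _ H (hfin _) (hfin _),
      ← cfc_mul _ _ H (hfin _) (hfin _), ← cfc_mul _ _ H (hfin _) (hfin _)]
    refine cfc_congr fun x hx => ?_
    by_cases h : Real.sqrt x = 0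
    · simp [h]
    · field_simp
  set W := K * Xᴴ with hW
  set F := Wᴴ * W with hF
  have hFh : Fᴴ = F := by simp [hF, Matrix.conjTranspose_mul]
  have hF' : F = X * (K * K) * Xᴴ := by
    simp [hF, hW, Matrix.conjTranspose_mul, hKh, Matrix.mul_assoc]
  have hFF : F * F = F := by
    calc F * F = X * (K * (K * H) * K * K) * Xᴴ := by
          rw [hF', hH]; simp only [Matrix.mul_assoc]
      _ = F := by rw [hKHK, hF']
  have hWA : ((W * A)ᴴ * (W * A)).trace.re ≤ (Aᴴ * A).trace.re := by
    have h := trace_conjTranspose_mul_self_re_nonneg ((1 - F) * A)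
    have e : ((1 - F) * A)ᴴ * ((1 - F) * A) = Aᴴ * A - (W * A)ᴴ * (W * A) := by
      have : (W * A)ᴴ * (W * A) = Aᴴ * F * A := by
        rw [hF]; simp only [Matrix.conjTranspose_mul, Matrix.mul_assoc]
      rw [this, Matrix.conjTranspose_mul, Matrix.conjTranspose_sub, hFh, Matrix.conjTranspose_one]
      have : (1 - F) * (1 - F) = 1 - F := IsIdempotentElem.one_sub hFF
      calc Aᴴ * (1 - F) * ((1 - F) * A) = Aᴴ * ((1 - F) * (1 - F)) * A := by
            simp only [Matrix.mul_assoc]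
        _ = _ := by rw [this]; noncomm_ring
    rw [e, Matrix.trace_sub, Complex.sub_re] at h
    linarith
  have htr : traceNorm X = ((W * A) * B).trace.re := by
    rw [traceNorm, ← hH, ← hKH, hW, hH, hX]
    simp only [Matrix.mul_assoc]
  rw [htr]
  calc ((W * A) * B).trace.re ^ 2 ≤ ‖((W * A) * B).trace‖ ^ 2 := by
        rw [← sq_abs]; gcongr; exact Complex.abs_re_le_norm _
    _ ≤ ((W * A)ᴴ * (W * A)).trace.re * (Bᴴ * B).trace.re := norm_trace_mul_sq_le _ _
    _ ≤ _ := by gcongr; exact trace_conjTranspose_mul_self_re_nonneg B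

lemma conjTranspose_cfc_sqrt (ρ : Matrix n n ℂ) : (cfc Real.sqrt ρ)ᴴ = cfc Real.sqrt ρ :=
  (cfc_predicate Real.sqrt ρ : IsSelfAdjoint _)

lemma cfc_sqrt_mul_self {ρ : Matrix n n ℂ} (hρ : ρ.PosSemidef) :
    cfc Real.sqrt ρ * cfc Real.sqrt ρ = ρ := by
  have hs : IsSelfAdjoint ρ := hρ.isHermitian
  rw [← cfc_mul _ _ ρ Real.continuous_sqrt.continuousOn Real.continuous_sqrt.continuousOn]
  conv_rhs => rw [← cfc_id' ℝ ρ]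
  refine cfc_congr fun x hx => ?_
  rw [hρ.isHermitian.spectrum_real_eq_range_eigenvalues] at hx
  obtain ⟨i, rfl⟩ := hx
  exact Real.mul_self_sqrt (hρ.eigenvalues_nonneg i)

/-- If the state `ρ` lies inside the projector `N`, then no state has a fidelity with `ρ` above its
weight in `N`. -/
lemma fidelity_le_of_projection {ρ σ N : Matrix n n ℂ} (hρ : IsState ρ) (hσ : σ.PosSemidef)
    (hN : Nᴴ = N) (hNN : N * N = N) (hρN : (ρ * N).trace = 1) :
    fidelity ρ σ ≤ (σ * N).trace.re := by
  set R := cfc Real.sqrt ρ with hR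
  set S := cfc Real.sqrt σ with hS
  have hRR : R * R = ρ := cfc_sqrt_mul_self hρ.1
  have hSS : S * S = σ := cfc_sqrt_mul_self hσ
  have hRh : Rᴴ = R := conjTranspose_cfc_sqrt ρ
  have hSh : Sᴴ = S := conjTranspose_cfc_sqrt σ
  have hR0 : R * (1 - N) = 0 := by
    rw [← Matrix.trace_conjTranspose_mul_self_eq_zero_iff]
    have h1 : (1 - N) * (1 - N) = 1 - N := IsIdempotentElem.one_sub hNN
    calc ((R * (1 - N))ᴴ * (R * (1 - N))).trace = ((1 - N) * (R * R * (1 - N))).trace := by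
          simp only [Matrix.conjTranspose_mul, hRh, Matrix.conjTranspose_sub,
            Matrix.conjTranspose_one, hN, Matrix.mul_assoc]
      _ = (ρ * ((1 - N) * (1 - N))).trace := by
          rw [Matrix.trace_mul_comm, hRR, Matrix.mul_assoc]
      _ = 0 := by rw [h1, mul_sub, Matrix.trace_sub, hρN, mul_one, hρ.2, sub_self]
  have hRN : R * S = R * (N * S) := by
    rw [mul_sub, mul_one, sub_eq_zero] at hR0
    rw [← Matrix.mul_assoc, ← hR0]
  have h := traceNorm_mul_sq_le R (N * S)
  rw [← hRN, hRh, hRR, hρ.2, Complex.one_re, one_mul, Matrix.conjTranspose_mul, hN, hSh] at h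
  calc fidelity ρ σ ≤ (S * N * (N * S)).trace.re := h
    _ = (σ * N).trace.re := by
      have : S * N * (N * S) = S * N * S := by
        rw [Matrix.mul_assoc, ← Matrix.mul_assoc N N S, hNN, Matrix.mul_assoc]
      rw [this, ← hSS, Matrix.trace_mul_comm, Matrix.mul_assoc]

/-- A state that is `δ`-close in purified distance to one inside the projector `N` has weight at
most `δ²` outside `N`. -/
lemma trace_mul_one_sub_le_of_purifiedDistance_le {ρ σ N : Matrix n n ℂ} {δ : ℝ} (hρ : IsState ρ)
    (hσ : IsState σ) (hN : Nᴴ = N) (hNN : N * N = N) (hρN : (ρ * N).trace = 1)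
    (h : purifiedDistance ρ σ ≤ δ) : (σ * (1 - N)).trace.re ≤ δ ^ 2 := by
  have hF := fidelity_le_of_projection hρ hσ.1 hN hNN hρN
  have h1 : 1 - fidelity ρ σ ≤ δ ^ 2 := (Real.sqrt_le_left ((Real.sqrt_nonneg _).trans h)).1 h
  rw [mul_sub, mul_one, Matrix.trace_sub, hσ.2, Complex.sub_re, Complex.one_re]
  linarith

end Fidelity

/-! ### Operators on a tensor factor -/

section Block

open scoped Kronecker

variable {n a b : Type*} [Fintype n] [DecidableEq n] [Fintype a] [DecidableEq a] [Fintype b]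
  [DecidableEq b]

/-- The embedding `O ↦ O ⊗ 1` of the operators on the first factor of `ℂⁿ ≅ ℂᵃ ⊗ ℂᵇ`, where the
factorization is given by a bijection of basis labels. -/
def blockEmbed (e : n ≃ a × b) : Matrix a a ℂ →⋆ₐ[ℂ] Matrix n n ℂ where
  toFun O := (O ⊗ₖ (1 : Matrix b b ℂ)).submatrix e e
  map_one' := by simp
  map_mul' O O' := by
    rw [Matrix.submatrix_mul_equiv, ← Matrix.mul_kronecker_mul, one_mul]
  map_zero' := by simp
  map_add' O O' := by rw [Matrix.add_kronecker]; rfl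
  commutes' c := by
    simp [Algebra.algebraMap_eq_smul_one, Matrix.smul_kronecker, Matrix.submatrix_smul]
  map_star' O := by
    simp [Matrix.star_eq_conjTranspose, Matrix.conjTranspose_kronecker]

lemma blockEmbed_apply (e : n ≃ a × b) (O : Matrix a a ℂ) (x y : n) :
    blockEmbed e O x y = if (e x).2 = (e y).2 then O (e x).1 (e y).1 else 0 := by
  simp [blockEmbed, Matrix.kroneckerMap_apply, Matrix.one_apply]

/-- The partial trace over the second factor. -/
def blockTrace (e : n ≃ a × b) (ρ : Matrix n n ℂ) : Matrix a a ℂ :=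
  ∑ c, ρ.submatrix (fun x => e.symm (x, c)) (fun x => e.symm (x, c))

lemma blockTrace_posSemidef (e : n ≃ a × b) {ρ : Matrix n n ℂ} (hρ : ρ.PosSemidef) :
    (blockTrace e ρ).PosSemidef :=
  Matrix.posSemidef_sum _ fun _ _ => hρ.submatrix _

/-- The partial trace is dual to the embedding of observables. -/
lemma trace_blockTrace_mul (e : n ≃ a × b) (ρ : Matrix n n ℂ) (O : Matrix a a ℂ) :
    (blockTrace e ρ * O).trace = (ρ * blockEmbed e O).trace := by
  have h : (ρ * blockEmbed e O).trace
      = ∑ z : a × b, ∑ w : a × b, ρ (e.symm z) (e.symm w) * blockEmbed e O (e.symm w) (e.symm z) := by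
    simp only [Matrix.trace, Matrix.diag, Matrix.mul_apply]
    rw [← e.symm.sum_comp]
    exact Finset.sum_congr rfl fun z _ => (e.symm.sum_comp _).symm
  rw [h]
  simp only [blockEmbed_apply, Equiv.apply_symm_apply, Fintype.sum_prod_type, mul_ite, mul_zero,
    Finset.sum_ite_eq', Finset.mem_univ, if_true, blockTrace, Matrix.trace, Matrix.diag,
    Matrix.mul_apply, Matrix.sum_apply, Matrix.submatrix_apply, Finset.sum_mul]
  refine Finset.sum_congr rfl fun x _ => ?_
  exact Finset.sum_comm

lemma trace_blockTrace (e : n ≃ a × b) (ρ : Matrix n n ℂ) : (blockTrace e ρ).trace = ρ.trace := by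
  simpa using trace_blockTrace_mul e ρ 1

lemma blockTrace_isState (e : n ≃ a × b) {ρ : Matrix n n ℂ} (hρ : IsState ρ) :
    IsState (blockTrace e ρ) :=
  ⟨blockTrace_posSemidef e hρ.1, (trace_blockTrace e ρ).trans hρ.2⟩

lemma blockEmbed_injective [Nonempty b] (e : n ≃ a × b) : Function.Injective (blockEmbed e) := by
  intro O O' h
  ext x y
  obtain ⟨c⟩ := ‹Nonempty b›
  simpa [blockEmbed_apply] using congr_fun₂ h (e.symm (x, c)) (e.symm (y, c))

end Block

section Systems

variable {V : Type*} [Fintype V] [DecidableEq V] {d : V → ℕ}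

open Classical in
/-- The splitting of the basis labels into the sites in `A` and the remaining ones. -/
def splitConf (d : V → ℕ) (A : Set V) :
    Conf d ≃ Conf (sub d A) × (∀ v : {v // ¬ v ∈ A}, Fin (d v)) :=
  Equiv.piEquivPiSubtypeProd (· ∈ A) fun v => Fin (d v)

open Classical in
/-- `ampliate` as a homomorphism of star-algebras. -/
def ampliateHom (d : V → ℕ) (A : Set V) : Op (sub d A) →⋆ₐ[ℂ] Op d := blockEmbed (splitConf d A)

open Classical in
lemma ampliateHom_apply (A : Set V) (O : Op (sub d A)) : ampliateHom d A O = ampliate A O := by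
  ext x y
  simp only [ampliateHom, blockEmbed_apply, ampliate, Matrix.of_apply]
  have h : ((splitConf d A) x).2 = ((splitConf d A) y).2 ↔ ∀ v ∉ A, x v = y v := by
    simp [splitConf, funext_iff]
  by_cases hc : ∀ v ∉ A, x v = y v
  · rw [if_pos hc, if_pos (h.2 hc)]
    rfl
  · rw [if_neg hc, if_neg (mt h.1 hc)]

open Classical in
lemma blockTrace_splitConf (A : Set V) (ρ : Op d) :
    blockTrace (splitConf d A) ρ = marginal A ρ := by
  ext a b
  simp only [blockTrace, marginal, Matrix.sum_apply, Matrix.submatrix_apply, Matrix.of_apply]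
  rfl

open Classical in
lemma trace_marginal_mul (A : Set V) (ρ : Op d) (O : Op (sub d A)) :
    (marginal A ρ * O).trace = (ρ * ampliate A O).trace := by
  rw [← blockTrace_splitConf, trace_blockTrace_mul, ← ampliateHom_apply, ampliateHom]

open Classical in
lemma marginal_isState (A : Set V) {ρ : Op d} (hρ : IsState ρ) : IsState (marginal A ρ) := by
  rw [← blockTrace_splitConf]
  exact blockTrace_isState _ hρ

open Classical in
/-- Marginals agree as soon as the expectation values of all local observables do. -/
lemma marginal_eq_of_forall_trace {A : Set V} {ρ σ : Op d}
    (h : ∀ O : Op (sub d A), (ρ * ampliate A O).trace = (σ * ampliate A O).trace) :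
    marginal A ρ = marginal A σ :=
  Matrix.ext_iff_trace_mul_right.2 fun O => by rw [trace_marginal_mul, trace_marginal_mul, h]

/-! ### Supports -/

/-- Support in terms of matrix entries: the operator leaves the labels off `A` alone, and its
entries do not depend on them. -/
lemma supportedOn_iff [∀ v, NeZero (d v)] {A : Set V} {O : Op d} : SupportedOn A O ↔
    (∀ x y, (∃ v ∉ A, x v ≠ y v) → O x y = 0) ∧
    (∀ x y x' y', (∀ v ∉ A, x v = y v) → (∀ v ∉ A, x' v = y' v) → (∀ v ∈ A, x v = x' v) →
      (∀ v ∈ A, y v = y' v) → O x y = O x' y') := by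
  classical
  constructor
  · rintro ⟨O', rfl⟩
    refine ⟨fun x y ⟨v, hv, h⟩ => ?_, fun x y x' y' h h' hx hy => ?_⟩
    · simp only [ampliate, Matrix.of_apply]
      rw [if_neg fun H => h (H v hv)]
    · simp only [ampliate, Matrix.of_apply]
      rw [if_pos h, if_pos h']
      congr 1
      · exact funext fun v => hx v v.2
      · exact funext fun v => hy v v.2
  · rintro ⟨h1, h2⟩
    refine ⟨Matrix.of fun a b => O (glue A a fun _ => 0) (glue A b fun _ => 0), ?_⟩
    ext x y
    simp only [ampliate, Matrix.of_apply]
    split_ifs with h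
    · refine h2 _ _ _ _ h (fun v hv => by simp [glue, hv]) (fun v hv => by simp [glue, hv])
        (fun v hv => by simp [glue, hv])
    · push Not at h
      exact h1 _ _ h

lemma SupportedOn.mono [∀ v, NeZero (d v)] {A B : Set V} {O : Op d} (h : SupportedOn A O)
    (hAB : A ⊆ B) : SupportedOn B O := by
  rw [supportedOn_iff] at h ⊢
  refine ⟨fun x y ⟨v, hv, hxy⟩ => h.1 x y ⟨v, fun hA => hv (hAB hA), hxy⟩,
    fun x y x' y' h1 h2 h3 h4 => ?_⟩
  -- on `B \ A` the labels `x`, `y` are those of `x'`, `y'`, so both entries vanish or neither has to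
  by_cases hc : ∀ v ∉ A, x v = y v
  · refine h.2 x y x' y' hc (fun v hv => ?_) (fun v hv => h3 v (hAB hv)) fun v hv => h4 v (hAB hv)
    by_cases hB : v ∈ B
    · rw [← h3 v hB, ← h4 v hB, hc v hv]
    · exact h2 v hB
  · push Not at hc
    obtain ⟨v, hv, hne⟩ := hc
    have hB : v ∈ B := by
      by_contra hB
      exact hne (h1 v hB)
    rw [h.1 x y ⟨v, hv, hne⟩, h.1 x' y' ⟨v, hv, by rwa [← h3 v hB, ← h4 v hB]⟩]

lemma SupportedOn.mul {A : Set V} {O O' : Op d} (h : SupportedOn A O) (h' : SupportedOn A O') :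
    SupportedOn A (O * O') := by
  classical
  obtain ⟨X, rfl⟩ := h
  obtain ⟨Y, rfl⟩ := h'
  exact ⟨X * Y, by simp only [← ampliateHom_apply, map_mul]⟩

lemma SupportedOn.conjTranspose {A : Set V} {O : Op d} (h : SupportedOn A O) :
    SupportedOn A Oᴴ := by
  classical
  obtain ⟨X, rfl⟩ := h
  refine ⟨Xᴴ, ?_⟩
  rw [← ampliateHom_apply, ← ampliateHom_apply]
  exact (map_star (ampliateHom d A) X).symm

lemma supportedOn_one (A : Set V) : SupportedOn A (1 : Op d) := by
  classical
  exact ⟨1, by rw [← ampliateHom_apply, map_one]⟩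

lemma SupportedOn.sub {A : Set V} {O O' : Op d} (h : SupportedOn A O) (h' : SupportedOn A O') :
    SupportedOn A (O - O') := by
  classical
  obtain ⟨X, rfl⟩ := h
  obtain ⟨Y, rfl⟩ := h'
  exact ⟨X - Y, by simp only [← ampliateHom_apply, map_sub]⟩

lemma SupportedOn.smul {A : Set V} {O : Op d} (h : SupportedOn A O) (c : ℂ) :
    SupportedOn A (c • O) := by
  classical
  obtain ⟨X, rfl⟩ := h
  exact ⟨c • X, by simp only [← ampliateHom_apply, map_smul]⟩

/-- In a product of operators with disjoint supports a single intermediate label contributes. -/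
lemma SupportedOn.mul_apply [∀ v, NeZero (d v)] {A B : Set V} {X Y : Op d} (hX : SupportedOn A X)
    (hY : SupportedOn B Y) (hAB : Disjoint A B) [DecidablePred (· ∈ A)] (x z : Conf d) :
    (X * Y) x z = X x (fun v => if v ∈ A then z v else x v) *
      Y (fun v => if v ∈ A then z v else x v) z := by
  rw [Matrix.mul_apply]
  refine Finset.sum_eq_single _ (fun y _ hy => ?_) (by simp)
  obtain ⟨v, hv⟩ := Function.ne_iff.1 hy
  rw [supportedOn_iff] at hX hY
  by_cases hA : v ∈ A
  · rw [hY.1 y z ⟨v, Set.disjoint_left.1 hAB hA, by simpa [hA] using hv⟩, mul_zero]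
  · rw [hX.1 x y ⟨v, hA, by simpa [hA] using hv.symm⟩, zero_mul]

/-- Operators with disjoint supports commute. -/
lemma SupportedOn.mul_comm [∀ v, NeZero (d v)] {A B : Set V} {X Y : Op d} (hX : SupportedOn A X)
    (hY : SupportedOn B Y) (hAB : Disjoint A B) : X * Y = Y * X := by
  classical
  ext x z
  rw [hX.mul_apply hY hAB, hY.mul_apply hX hAB.symm, _root_.mul_comm]
  rw [supportedOn_iff] at hX hY
  by_cases h : ∀ v, v ∉ A → v ∉ B → x v = z v
  · congr 1
    · refine hY.2 _ _ _ _ ?_ ?_ ?_ ?_ <;> intro v hv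
      · by_cases hA : v ∈ A
        · simp [hA]
        · simp [hA, h v hA hv]
      · simp [hv]
      · simp [Set.disjoint_right.1 hAB hv]
      · simp [hv]
    · refine hX.2 _ _ _ _ ?_ ?_ ?_ ?_ <;> intro v hv
      · simp [hv]
      · by_cases hB : v ∈ B
        · simp [hB]
        · simp [hB, h v hv hB]
      · simp [Set.disjoint_left.1 hAB hv]
      · simp [hv]
  · push Not at h
    obtain ⟨v, hA, hB, hne⟩ := h
    rw [hY.1 _ _ ⟨v, hB, by simpa [hA] using hne⟩, hX.1 _ z ⟨v, hA, by simpa [hB] using hne⟩]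
    simp

end Systems

/-! ### Discs in the lattice and in its extension -/

section Geometry

variable {V : Type*} {G : SimpleGraph V}

lemma edist_le_add {u v w : V} {a b : ℕ} (h : G.edist u v ≤ a) (h' : G.edist v w ≤ b) :
    G.edist u w ≤ (a + b : ℕ) := by
  rw [Nat.cast_add]
  exact SimpleGraph.edist_triangle.trans (add_le_add h h')

lemma disc_mono (v : V) {r s : ℕ} (h : r ≤ s) : disc G v r ⊆ disc G v s :=
  fun u (hu : G.edist v u ≤ r) => hu.trans (by exact_mod_cast h)

lemma subset_thicken (A : Set V) (r : ℕ) : A ⊆ thicken G A r :=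
  fun u hu => ⟨u, hu, by simp [disc]⟩

lemma thicken_thicken_subset (A : Set V) (r s : ℕ) :
    thicken G (thicken G A r) s ⊆ thicken G A (r + s) :=
  fun _ ⟨_, ⟨w, hw, hv⟩, hu⟩ => ⟨w, hw, edist_le_add hv hu⟩

variable {Λ E : Type*} {G : SimpleGraph Λ} {G' : SimpleGraph (Λ ⊕ E)}

/-- Inside a disc of the extended lattice that contains no ancilla, distances from the centre are
those of the lattice. -/
lemma exists_edist_le_of_disc_subset (hG : G'.comap Sum.inl = G) {u : Λ} {r : ℕ}
    (hr : disc G' (Sum.inl u) r ⊆ Set.range Sum.inl) {w : Λ ⊕ E}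
    (hw : G'.edist (Sum.inl u) w ≤ r) : ∃ w', Sum.inl w' = w ∧ G.edist u w' ≤ r := by
  have key : ∀ {x w : Λ ⊕ E} (p : G'.Walk x w) (u : Λ), Sum.inl u = x →
      disc G' x p.length ⊆ Set.range Sum.inl →
      ∃ w', Sum.inl w' = w ∧ G.edist u w' ≤ p.length := by
    intro x w p
    induction p with
    | nil => exact fun u hu _ => ⟨u, hu, by simp⟩
    | @cons x y w hxy p ih =>
      intro u hu hsub
      have hy : G'.edist x y ≤ (1 : ℕ) := by
        rw [Nat.cast_one, SimpleGraph.edist_le_one_iff_adj_or_eq]; exact Or.inl hxy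
      obtain ⟨v, hv⟩ : y ∈ Set.range Sum.inl := by
        refine hsub (le_trans hy ?_)
        simp [SimpleGraph.Walk.length_cons]
      obtain ⟨w', hw', hd⟩ := ih v hv fun z hz => hsub (by
        have := edist_le_add hy hz
        rwa [add_comm] at this)
      refine ⟨w', hw', ?_⟩
      have huv : G.edist u v ≤ (1 : ℕ) := by
        rw [Nat.cast_one, SimpleGraph.edist_le_one_iff_adj_or_eq]
        left
        rw [← hG, SimpleGraph.comap_adj, hu, hv]
        exact hxy
      have := edist_le_add huv hd
      rwa [add_comm] at this
  obtain ⟨p, hp⟩ := SimpleGraph.exists_walk_of_edist_ne_top (ne_top_of_le_ne_top (by simp) hw)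
  have hpr : p.length ≤ r := by exact_mod_cast hp.trans_le hw
  obtain ⟨w', h1, h2⟩ := key p u rfl fun z hz =>
    hr (le_trans (show G'.edist _ z ≤ _ from hz) (by exact_mod_cast hpr))
  exact ⟨w', h1, h2.trans (by exact_mod_cast hpr)⟩

lemma edist_inl_le (hG : G'.comap Sum.inl = G) {u w : Λ} {r : ℕ} (h : G.edist u w ≤ r) :
    G'.edist (Sum.inl u) (Sum.inl w) ≤ r := by
  obtain ⟨p, hp⟩ := SimpleGraph.exists_walk_of_edist_ne_top (ne_top_of_le_ne_top (by simp) h)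
  let f : G →g G' := ⟨Sum.inl, fun {a b} hab => by rw [← hG] at hab; exact hab⟩
  refine le_trans (SimpleGraph.Walk.edist_le (p.map f)) ?_
  rw [SimpleGraph.Walk.length_map, hp]
  exact h

/-- A disc of the extended lattice that contains no ancilla controls the neighbourhoods of all the
sites well inside it. -/
lemma exists_edist_le_of_mem_disc (hG : G'.comap Sum.inl = G) {c u : Λ} {a b r : ℕ}
    (hr : disc G' (Sum.inl c) r ⊆ Set.range Sum.inl) (hab : a + b ≤ r) (hu : G.edist c u ≤ a)
    {w : Λ ⊕ E} (hw : G'.edist (Sum.inl u) w ≤ b) : ∃ w', Sum.inl w' = w ∧ G.edist u w' ≤ b := by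
  refine exists_edist_le_of_disc_subset hG (fun z hz => hr ?_) hw
  refine le_trans (edist_le_add (edist_inl_le hG hu) (show G'.edist (Sum.inl u) z ≤ b from hz)) ?_
  exact_mod_cast hab

lemma thicken_image_disc_subset (hG : G'.comap Sum.inl = G) {c : Λ} {a b r : ℕ}
    (hr : disc G' (Sum.inl c) r ⊆ Set.range Sum.inl) (hab : a + b ≤ r) :
    thicken G' (Sum.inl '' disc G c a) b ⊆ Sum.inl '' disc G c (a + b) := by
  rintro w ⟨_, ⟨u, hu, rfl⟩, hw⟩
  obtain ⟨w', rfl, h⟩ := exists_edist_le_of_mem_disc hG hr hab hu hw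
  exact ⟨w', edist_le_add hu h, rfl⟩

/-- If the thickening of a set in the lattice avoids a disc, then so does its thickening in the
extended lattice, provided that there are no ancillas around the disc. -/
lemma disjoint_image_disc_thicken (hG : G'.comap Sum.inl = G) {c : Λ} {a b r : ℕ}
    (hr : disc G' (Sum.inl c) r ⊆ Set.range Sum.inl) (hab : a + b ≤ r) {Y : Set Λ}
    (hY : ∀ u ∈ Y, ∀ w ∈ disc G c a, ¬ G.edist w u ≤ b) :
    Disjoint (Sum.inl '' disc G c a) (thicken G' (Sum.inl '' Y) b) := by
  rw [Set.disjoint_left]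
  rintro _ ⟨w, hw, rfl⟩ ⟨_, ⟨u, hu, rfl⟩, hd⟩
  have hd' : G'.edist (Sum.inl w) (Sum.inl u) ≤ b := by rw [SimpleGraph.edist_comm]; exact hd
  obtain ⟨w', h1, h2⟩ := exists_edist_le_of_mem_disc hG hr hab hw hd'
  obtain rfl := Sum.inl_injective h1
  exact hY _ hu w hw h2

end Geometry

/-! ### The light cone of a local circuit -/

section LightCone

variable {V : Type*} [Fintype V] [DecidableEq V] {G : SimpleGraph V} {d : V → ℕ}

/-- Conjugation by one layer: the gates that miss `A` cancel, and the others reach at most one site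
further. -/
lemma IsLayer.supportedOn_conj [∀ v, NeZero (d v)] {L : Op d} (hL : IsLayer G L) {A : Set V}
    {O : Op d} (hO : SupportedOn A O) : SupportedOn (thicken G A 1) (L * O * Lᴴ) := by
  obtain ⟨gates, hg, hp, rfl⟩ := hL
  suffices h : SupportedOn (A ∪ ⋃ g ∈ {g | g ∈ gates ∧ ¬ Disjoint g.1 A}, g.1)
      ((gates.map Prod.snd).prod * O * (gates.map Prod.snd).prodᴴ) by
    refine h.mono (Set.union_subset (subset_thicken A 1) ?_)
    refine Set.iUnion₂_subset fun g hgA w hw => ?_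
    obtain ⟨⟨u, v, huv, hset⟩, -, -⟩ := hg g hgA.1
    obtain ⟨x, hx, hxA⟩ := Set.not_disjoint_iff.1 hgA.2
    refine ⟨x, hxA, ?_⟩
    change G.edist x w ≤ (1 : ℕ)
    rw [Nat.cast_one, SimpleGraph.edist_le_one_iff_adj_or_eq]
    rw [hset] at hx hw
    have huv' := huv.imp_right fun h => h.symm
    rcases hx with rfl | rfl <;> rcases hw with rfl | rfl <;> tauto
  induction gates with
  | nil => simpa using hO
  | cons g gs ih =>
    rw [List.pairwise_cons] at hp
    have ih' := ih (fun g h => hg g (List.mem_cons_of_mem _ h)) hp.2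
    obtain ⟨-, hsupp, hunit⟩ := hg g List.mem_cons_self
    set W := (gs.map Prod.snd).prod
    have hmono : (A ∪ ⋃ h ∈ {h | h ∈ gs ∧ ¬ Disjoint h.1 A}, h.1) ⊆
        A ∪ ⋃ h ∈ {h | h ∈ g :: gs ∧ ¬ Disjoint h.1 A}, h.1 :=
      Set.union_subset_union_right _ (Set.biUnion_subset_biUnion_left
        fun h hh => ⟨List.mem_cons_of_mem _ hh.1, hh.2⟩)
    have e : ((g :: gs).map Prod.snd).prod * O * ((g :: gs).map Prod.snd).prodᴴ
        = g.2 * (W * O * Wᴴ) * g.2ᴴ := by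
      simp [W, Matrix.conjTranspose_mul, Matrix.mul_assoc]
    rw [e]
    by_cases hgA : Disjoint g.1 A
    · have hdis : Disjoint g.1 (A ∪ ⋃ h ∈ {h | h ∈ gs ∧ ¬ Disjoint h.1 A}, h.1) := by
        rw [Set.disjoint_union_right, Set.disjoint_iUnion₂_right]
        exact ⟨hgA, fun h hh => hp.1 h hh.1⟩
      have hgg : g.2 * g.2ᴴ = 1 := Matrix.mem_unitaryGroup_iff.1 hunit
      rw [hsupp.mul_comm ih' hdis, Matrix.mul_assoc, hgg, mul_one]
      exact ih'.mono hmono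
    · have hsub : g.1 ⊆ A ∪ ⋃ h ∈ {h | h ∈ g :: gs ∧ ¬ Disjoint h.1 A}, h.1 :=
        (Set.subset_biUnion_of_mem (u := fun h : Set V × Op d => h.1)
          (show g ∈ {h | h ∈ g :: gs ∧ ¬ Disjoint h.1 A} from ⟨List.mem_cons_self, hgA⟩)).trans
          Set.subset_union_right
      exact ((hsupp.mono hsub).mul (ih'.mono hmono)).mul (hsupp.mono hsub).conjTranspose

lemma IsLayer.mem_unitaryGroup {L : Op d} (hL : IsLayer G L) :
    L ∈ Matrix.unitaryGroup (Conf d) ℂ := by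
  obtain ⟨gates, hg, -, rfl⟩ := hL
  refine Submonoid.list_prod_mem _ fun x hx => ?_
  obtain ⟨g, hgm, rfl⟩ := List.mem_map.1 hx
  exact (hg g hgm).2.2

lemma IsLayer.conjTranspose {L : Op d} (hL : IsLayer G L) : IsLayer G Lᴴ := by
  obtain ⟨gates, hg, hp, rfl⟩ := hL
  refine ⟨(gates.map fun g => (g.1, g.2ᴴ)).reverse, ?_, ?_, ?_⟩
  · intro g' hg'
    obtain ⟨g, hgm, rfl⟩ := List.mem_map.1 (List.mem_reverse.1 hg')
    obtain ⟨h1, h2, h3⟩ := hg g hgm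
    exact ⟨h1, h2.conjTranspose, Unitary.star_mem h3⟩
  · rw [List.pairwise_reverse, List.pairwise_map]
    exact hp.imp fun h => h.symm
  · rw [Matrix.conjTranspose_list_prod]
    simp [List.map_reverse, List.map_map, Function.comp_def]

lemma IsLocalCircuit.mem_unitaryGroup {D : ℕ} {U : Op d} (hU : IsLocalCircuit G D U) :
    U ∈ Matrix.unitaryGroup (Conf d) ℂ := by
  obtain ⟨l, -, hl, rfl⟩ := hU
  exact Submonoid.list_prod_mem _ fun L hL => (hl L hL).mem_unitaryGroup

lemma IsLocalCircuit.conjTranspose {D : ℕ} {U : Op d} (hU : IsLocalCircuit G D U) :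
    IsLocalCircuit G D Uᴴ := by
  obtain ⟨l, hlen, hl, rfl⟩ := hU
  refine ⟨(l.map Matrix.conjTranspose).reverse, by simpa using hlen, fun L' hL' => ?_,
    Matrix.conjTranspose_list_prod l⟩
  obtain ⟨L, hL, rfl⟩ := List.mem_map.1 (List.mem_reverse.1 hL')
  exact (hl L hL).conjTranspose

/-- Conjugation by a circuit of depth `D` spreads supports by at most `D`. -/
lemma IsLocalCircuit.supportedOn_conj [∀ v, NeZero (d v)] {D : ℕ} {U : Op d}
    (hU : IsLocalCircuit G D U) {A : Set V} {O : Op d} (hO : SupportedOn A O) :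
    SupportedOn (thicken G A D) (U * O * Uᴴ) := by
  obtain ⟨l, rfl, hl, rfl⟩ := hU
  induction l with
  | nil => simpa using hO.mono (subset_thicken A 0)
  | cons L l ih =>
    have h := (hl L List.mem_cons_self).supportedOn_conj
      (ih fun L h => hl L (List.mem_cons_of_mem _ h))
    have e : (L :: l).prod * O * (L :: l).prodᴴ = L * (l.prod * O * l.prodᴴ) * Lᴴ := by
      simp [Matrix.conjTranspose_mul, Matrix.mul_assoc]
    rw [e]
    exact h.mono (thicken_thicken_subset A _ _)

end LightCone

section Vacuum

open scoped Matrix.Norms.L2Operator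

variable {V : Type*} [Fintype V] [DecidableEq V] {d : V → ℕ} [∀ v, NeZero (d v)]

/-! ### The product state -/

/-- The projector onto `|0⟩` at all the sites of `A`, acting trivially on the other sites. -/
def vacProj (d : V → ℕ) [∀ v, NeZero (d v)] (A : Set V) : Op d :=
  open Classical in Matrix.diagonal fun x => if ∀ v ∈ A, x v = 0 then 1 else 0

lemma vacProj_mul (A B : Set V) : vacProj d A * vacProj d B = vacProj d (A ∪ B) := by
  classical
  simp only [vacProj, Matrix.diagonal_mul_diagonal]
  congr 1
  ext x
  simp only [Set.mem_union, or_imp, forall_and]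
  split_ifs <;> simp_all

lemma vacProj_mul_self (A : Set V) : vacProj d A * vacProj d A = vacProj d A := by
  rw [vacProj_mul, Set.union_self]

lemma vacProj_conjTranspose (A : Set V) : (vacProj d A)ᴴ = vacProj d A := by
  classical
  simp only [vacProj, Matrix.diagonal_conjTranspose]
  congr 1
  ext x
  by_cases h : ∀ v ∈ A, x v = 0 <;> simp [h]

lemma supportedOn_vacProj (A : Set V) : SupportedOn A (vacProj d A) := by
  classical
  rw [supportedOn_iff]
  refine ⟨fun x y ⟨v, _, h⟩ => ?_, fun x y x' y' h1 h2 h3 h4 => ?_⟩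
  · rw [vacProj, Matrix.diagonal_apply_ne]
    exact fun e => h (congr_fun e v)
  · have hxy : x = y ↔ x' = y' := by
      constructor <;> intro h <;> ext v : 1 <;> by_cases hv : v ∈ A
      · rw [← h3 v hv, ← h4 v hv, h]
      · exact h2 v hv
      · rw [h3 v hv, h4 v hv, h]
      · exact h1 v hv
    have h0 : (∀ v ∈ A, x v = 0) ↔ ∀ v ∈ A, x' v = 0 :=
      forall₂_congr fun v hv => by rw [h3 v hv]
    simp only [vacProj, Matrix.diagonal_apply, hxy, h0]

/-- Sandwiching a local operator between product states leaves its expectation value. -/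
lemma vacProj_mul_mul_vacProj {A : Set V} {Y : Op d} (hY : SupportedOn A Y) :
    vacProj d A * Y * vacProj d A = Y 0 0 • vacProj d A := by
  classical
  rw [supportedOn_iff] at hY
  ext x y
  simp only [vacProj, Matrix.mul_diagonal, Matrix.diagonal_mul, Matrix.smul_apply, smul_eq_mul,
    Matrix.diagonal_apply]
  by_cases hx : ∀ v ∈ A, x v = 0
  · by_cases hy : ∀ v ∈ A, y v = 0
    · by_cases hxy : x = y
      · subst hxy
        rw [if_pos hx, if_pos rfl, one_mul, mul_one, mul_one]
        exact hY.2 _ _ _ _ (fun _ _ => rfl) (fun _ _ => rfl) hx hx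
      · obtain ⟨v, hv⟩ := Function.ne_iff.1 hxy
        have hvA : v ∉ A := fun h => hv (by rw [hx v h, hy v h])
        rw [hY.1 x y ⟨v, hvA, hv⟩, if_neg hxy]
        simp
    · rw [if_neg hy, mul_zero]
      split_ifs with h
      · exact absurd (h ▸ hx) hy
      · simp
  · simp [hx]

lemma mul_vacProj_apply_zero (X : Op d) (A : Set V) (x : Conf d) : (X * vacProj d A) x 0 = X x 0 := by
  classical
  simp [vacProj, Matrix.mul_diagonal]

lemma vacProj_mul_apply_zero (X : Op d) (A : Set V) (x : Conf d) : (vacProj d A * X) 0 x = X 0 x := by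
  classical
  simp [vacProj, Matrix.diagonal_mul]

lemma norm_vacProj_le (A : Set V) : ‖vacProj d A‖ ≤ 1 := by
  classical
  rw [vacProj, Matrix.l2_opNorm_diagonal, pi_norm_le_iff_of_nonneg zero_le_one]
  intro x
  split_ifs <;> simp

/-- The norm of the vector `X |0 ⋯ 0⟩`. -/
def vacNorm (X : Op d) : ℝ := ‖(WithLp.toLp 2 fun x => X x 0 : EuclideanSpace ℂ (Conf d))‖

lemma vacNorm_nonneg (X : Op d) : 0 ≤ vacNorm X := norm_nonneg _

lemma vacNorm_sq (X : Op d) : vacNorm X ^ 2 = ((Xᴴ * X) 0 0).re := by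
  rw [vacNorm, EuclideanSpace.norm_sq_eq, Matrix.mul_apply, Complex.re_sum]
  refine Finset.sum_congr rfl fun x _ => ?_
  rw [Matrix.conjTranspose_apply, Complex.star_def, ← Complex.normSq_eq_conj_mul_self,
    Complex.ofReal_re, Complex.normSq_eq_norm_sq]

lemma vacNorm_add_le (X Y : Op d) : vacNorm (X + Y) ≤ vacNorm X + vacNorm Y :=
  norm_add_le (WithLp.toLp 2 fun x => X x 0 : EuclideanSpace ℂ (Conf d))
    (WithLp.toLp 2 fun x => Y x 0)

lemma vacNorm_congr {X Y : Op d} (h : ∀ x, X x 0 = Y x 0) : vacNorm X = vacNorm Y := by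
  simp only [vacNorm, h]

lemma vacNorm_mul_le (X Y : Op d) : vacNorm (X * Y) ≤ ‖X‖ * vacNorm Y :=
  Matrix.l2_opNorm_mulVec X (WithLp.toLp 2 fun x => Y x 0)

lemma vacNorm_one : vacNorm (1 : Op d) = 1 := by
  have h := vacNorm_sq (1 : Op d)
  rw [Matrix.conjTranspose_one, mul_one, Matrix.one_apply_eq, Complex.one_re] at h
  exact (pow_eq_one_iff_of_nonneg (vacNorm_nonneg _) two_ne_zero).1 h

lemma vacNorm_le_norm (X : Op d) : vacNorm X ≤ ‖X‖ := by
  simpa [vacNorm_one] using vacNorm_mul_le X 1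

lemma norm_apply_zero_le (X : Op d) : ‖X 0 0‖ ≤ vacNorm X :=
  PiLp.norm_apply_le (WithLp.toLp 2 fun x => X x 0 : EuclideanSpace ℂ (Conf d)) 0

/-- The weight outside of a union of regions is at most the sum of the weights outside of each. -/
lemma vacNorm_one_sub_vacProj_biUnion_le {ι : Type*} (s : Finset ι) (A : ι → Set V) (X : Op d)
    {ε : ℝ} (h : ∀ i ∈ s, vacNorm ((1 - vacProj d (A i)) * X) ≤ ε) :
    vacNorm ((1 - vacProj d (⋃ i ∈ s, A i)) * X) ≤ s.card * ε := by
  classical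
  induction s using Finset.induction_on with
  | empty =>
    have : vacProj d (∅ : Set V) = 1 := by simp [vacProj]
    simp only [this, sub_self, zero_mul, Finset.notMem_empty, Set.iUnion_of_empty,
      Set.iUnion_empty, Finset.card_empty, Nat.cast_zero]
    exact (norm_zero (E := EuclideanSpace ℂ (Conf d))).le
  | insert i s hi ih =>
    rw [Finset.set_biUnion_insert, ← vacProj_mul, Finset.card_insert_of_notMem hi]
    have e : (1 - vacProj d (A i) * vacProj d (⋃ j ∈ s, A j)) * X
        = (1 - vacProj d (A i)) * X
          + vacProj d (A i) * ((1 - vacProj d (⋃ j ∈ s, A j)) * X) := by noncomm_ring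
    rw [e]
    have h1 := h i (Finset.mem_insert_self i s)
    have h2 := ih fun j hj => h j (Finset.mem_insert_of_mem hj)
    have h3 := (vacNorm_mul_le (vacProj d (A i)) ((1 - vacProj d (⋃ j ∈ s, A j)) * X)).trans
      (mul_le_of_le_one_left (vacNorm_nonneg _) (norm_vacProj_le _))
    have h4 := vacNorm_add_le ((1 - vacProj d (A i)) * X)
      (vacProj d (A i) * ((1 - vacProj d (⋃ j ∈ s, A j)) * X))
    push_cast
    linarith

/-- Product states have no correlations. -/
lemma apply_zero_mul_of_disjoint {A B : Set V} {X Y : Op d} (hX : SupportedOn A X)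
    (hY : SupportedOn B Y) (hAB : Disjoint A B) : (X * Y) 0 0 = X 0 0 * Y 0 0 := by
  have hc : Y * vacProj d A = vacProj d A * Y := hY.mul_comm (supportedOn_vacProj A) hAB.symm
  calc (X * Y) 0 0 = (vacProj d A * (X * Y * vacProj d A)) 0 0 := by
        rw [vacProj_mul_apply_zero, mul_vacProj_apply_zero]
    _ = (vacProj d A * X * vacProj d A * Y) 0 0 := by
        simp only [Matrix.mul_assoc, hc]
    _ = X 0 0 * Y 0 0 := by
        rw [vacProj_mul_mul_vacProj hX, Matrix.smul_mul, Matrix.smul_apply,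
          vacProj_mul_apply_zero, smul_eq_mul]

/-- The norm of a local operator on vectors that are `|0⟩` on its support. -/
lemma vacNorm_mul_vacProj_mul {A : Set V} {X : Op d} (hX : SupportedOn A X) (Y : Op d) :
    vacNorm (X * (vacProj d A * Y)) = vacNorm X * vacNorm (vacProj d A * Y) := by
  have hXX : (Xᴴ * X) 0 0 = ((vacNorm X ^ 2 : ℝ) : ℂ) := by
    rw [vacNorm_sq]
    refine (Complex.conj_eq_iff_re.1 ?_).symm
    have : (Xᴴ * X)ᴴ = Xᴴ * X := by simp [Matrix.conjTranspose_mul]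
    exact congr_fun₂ this 0 0
  rw [← sq_eq_sq₀ (vacNorm_nonneg _) (mul_nonneg (vacNorm_nonneg _) (vacNorm_nonneg _)), mul_pow,
    vacNorm_sq, vacNorm_sq (vacProj d A * Y)]
  have e : (X * (vacProj d A * Y))ᴴ * (X * (vacProj d A * Y))
      = ((vacNorm X ^ 2 : ℝ) : ℂ) • ((vacProj d A * Y)ᴴ * (vacProj d A * Y)) := by
    calc (X * (vacProj d A * Y))ᴴ * (X * (vacProj d A * Y))
        = Yᴴ * (vacProj d A * (Xᴴ * X) * vacProj d A) * Y := by
          simp only [Matrix.conjTranspose_mul, vacProj_conjTranspose, Matrix.mul_assoc]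
      _ = ((vacNorm X ^ 2 : ℝ) : ℂ) • (Yᴴ * (vacProj d A * vacProj d A) * Y) := by
          rw [vacProj_mul_mul_vacProj (hX.conjTranspose.mul hX), hXX, vacProj_mul_self]
          simp only [Matrix.mul_smul, Matrix.smul_mul]
      _ = _ := by simp only [Matrix.conjTranspose_mul, vacProj_conjTranspose, Matrix.mul_assoc]
  rw [e, Matrix.smul_apply, smul_eq_mul, Complex.re_ofReal_mul]

/-! ### Restricting operators to a region -/

/-- The matrix elements of `X` between states that are `|0⟩` off `A`. -/
def compress (A : Set V) (X : Op d) : Op (sub d A) :=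
  X.submatrix (fun a => glue A a fun _ => 0) (fun a => glue A a fun _ => 0)

/-- The slice map by the product state off `A`; unlike the normalized partial trace it is visibly a
contraction, and like it it factorizes over products of operators with disjoint supports. -/
def slice (A : Set V) (X : Op d) : Op d := ampliate A (compress A X)

open Classical in
lemma norm_ampliate_le (A : Set V) (O : Op (sub d A)) : ‖ampliate A O‖ ≤ ‖O‖ := by
  rw [← ampliateHom_apply]
  exact NonUnitalStarAlgHom.norm_apply_le _ _

lemma glue_zero_apply (A : Set V) [DecidablePred (· ∈ A)] (a : Conf (sub d A)) (v : V) :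
    glue A a (fun _ => 0) v = if h : v ∈ A then a ⟨v, h⟩ else 0 := by
  simp only [glue]

lemma glue_zero_injective (A : Set V) :
    Function.Injective fun a : Conf (sub d A) => (glue A a fun _ => 0 : Conf d) := by
  classical
  intro a b h
  ext ⟨v, hv⟩ : 1
  simpa [glue_zero_apply, hv] using congr_fun h v

open Classical in
lemma norm_compress_le (A : Set V) (X : Op d) : ‖compress A X‖ ≤ ‖X‖ := by
  set ι : Conf (sub d A) → Conf d := fun a => glue A a fun _ => 0 with hι
  set F : Matrix (Conf d) (Conf (sub d A)) ℂ := (1 : Op d).submatrix id ι with hF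
  have h1 : Fᴴ * F = 1 := by
    ext a b
    simp [hF, Matrix.mul_apply, Matrix.one_apply, (glue_zero_injective A).eq_iff, hι, eq_comm]
  have h2 : ‖F‖ ≤ 1 := by
    have h := Matrix.l2_opNorm_conjTranspose_mul_self F
    rw [h1] at h
    have h3 : ‖(1 : Op (sub d A))‖ ≤ 1 := by
      rw [← Matrix.diagonal_one, Matrix.l2_opNorm_diagonal, pi_norm_le_iff_of_nonneg zero_le_one]
      simp
    nlinarith [norm_nonneg F]
  have h3 : compress A X = Fᴴ * X * F := by
    ext a b
    simp [hF, compress, hι, Matrix.mul_apply, Matrix.one_apply]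
  rw [h3]
  calc ‖Fᴴ * X * F‖ ≤ ‖Fᴴ‖ * ‖X‖ * ‖F‖ :=
        (Matrix.l2_opNorm_mul _ _).trans (by gcongr; exact Matrix.l2_opNorm_mul _ _)
    _ ≤ 1 * ‖X‖ * 1 := by
        rw [Matrix.l2_opNorm_conjTranspose]
        gcongr
    _ = ‖X‖ := by ring

lemma norm_slice_le (A : Set V) (X : Op d) : ‖slice A X‖ ≤ ‖X‖ := by
  classical
  exact (norm_ampliate_le A _).trans (norm_compress_le A X)

lemma slice_eq_self {A : Set V} {X : Op d} (hX : SupportedOn A X) : slice A X = X := by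
  classical
  obtain ⟨O, rfl⟩ := hX
  rw [slice]
  congr 1
  ext a b
  have h : ∀ v ∉ A, glue A a (fun _ => 0) v = (glue A b (fun _ => 0) v : Fin (d v)) := fun v hv => by
    simp [glue_zero_apply, hv]
  simp only [compress, Matrix.submatrix_apply, ampliate, Matrix.of_apply]
  rw [if_pos h]
  congr 1 <;> ext ⟨v, hv⟩ : 1 <;> simp [glue_zero_apply, hv]

lemma slice_sum {ι : Type*} (s : Finset ι) (A : Set V) (X : ι → Op d) :
    slice A (∑ i ∈ s, X i) = ∑ i ∈ s, slice A (X i) := by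
  classical
  have h : compress A (∑ i ∈ s, X i) = ∑ i ∈ s, compress A (X i) := by
    ext a b
    simp [compress, Matrix.sum_apply]
  simp only [slice, h, ← ampliateHom_apply, map_sum]

lemma slice_mul {A M N : Set V} {X Y : Op d} (hX : SupportedOn M X) (hY : SupportedOn N Y)
    (hMN : Disjoint M N) : slice A (X * Y) = slice A X * slice A Y := by
  classical
  have h : compress A (X * Y) = compress A X * compress A Y := by
    ext a b
    rw [compress, Matrix.submatrix_apply, hX.mul_apply hY hMN, Matrix.mul_apply]
    rw [Finset.sum_eq_single (fun v : A => if (v : V) ∈ M then b v else a v)]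
    · have : (fun v => if v ∈ M then glue A b (fun _ => 0) v else glue A a (fun _ => 0) v)
          = (glue A (fun v : A => if (v : V) ∈ M then b v else a v) fun _ => 0 : Conf d) := by
        ext v : 1
        by_cases hv : v ∈ A <;> by_cases hM : v ∈ M <;> simp [glue_zero_apply, hv, hM]
      rw [this]
      rfl
    · intro c _ hc
      obtain ⟨⟨v, hvA⟩, hv⟩ := Function.ne_iff.1 hc
      rw [supportedOn_iff] at hX hY
      simp only [compress, Matrix.submatrix_apply]
      by_cases hM : v ∈ M
      · rw [hY.1 _ _ ⟨v, Set.disjoint_left.1 hMN hM, by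
          simpa [glue_zero_apply, hvA, hM] using hv⟩, mul_zero]
      · rw [hX.1 _ _ ⟨v, hM, by simpa [glue_zero_apply, hvA, hM] using Ne.symm hv⟩, zero_mul]
    · simp
  simp only [slice, h, ← ampliateHom_apply, map_mul]

lemma SupportedOn.slice {A M : Set V} {X : Op d} (hX : SupportedOn M X) :
    SupportedOn (A ∩ M) (slice A X) := by
  classical
  rw [supportedOn_iff] at hX ⊢
  simp only [TwistWitness.slice, ampliate, Matrix.of_apply, compress, Matrix.submatrix_apply]
  refine ⟨fun x y ⟨v, hv, hne⟩ => ?_, fun x y x' y' h1 h2 h3 h4 => ?_⟩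
  · split_ifs with h
    · have hvA : v ∈ A := by
        by_contra hA
        exact hne (h v hA)
      exact hX.1 _ _ ⟨v, fun hM => hv ⟨hvA, hM⟩, by simpa [glue_zero_apply, hvA] using hne⟩
    · rfl
  · rw [if_pos fun v hv => h1 v fun h => hv h.1, if_pos fun v hv => h2 v fun h => hv h.1]
    refine hX.2 _ _ _ _ ?_ ?_ ?_ ?_ <;> intro v hv <;> by_cases hA : v ∈ A <;>
      simp [glue_zero_apply, hA]
    · exact h1 v fun h => hv h.2
    · exact h2 v fun h => hv h.2
    · exact h3 v ⟨hA, hv⟩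
    · exact h4 v ⟨hA, hv⟩

end Vacuum

/-! ### The Heisenberg picture on the extended lattice -/

section Frame

open scoped Matrix.Norms.L2Operator

variable {Λ E : Type*} [Fintype Λ] [DecidableEq Λ] [Fintype E] [DecidableEq E]
  {d : Λ ⊕ E → ℕ}

/-- The embedding `O ↦ O ⊗ 1` of the operators on the lattice. -/
def latticeHom (d : Λ ⊕ E → ℕ) : Op (onLattice d) →⋆ₐ[ℂ] Op d :=
  blockEmbed (Equiv.sumPiEquivProdPi fun v => Fin (d v))

lemma latticeHom_apply (O : Op (onLattice d)) (x y : Conf d) :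
    latticeHom d O x y = if (fun w => x (Sum.inr w)) = (fun w => y (Sum.inr w)) then
      O (fun v => x (Sum.inl v)) (fun v => y (Sum.inl v)) else 0 :=
  blockEmbed_apply _ _ _ _

lemma latticeState_eq (ψ : Conf d → ℂ) : latticeState ψ =
    blockTrace (Equiv.sumPiEquivProdPi fun v => Fin (d v)) (Matrix.vecMulVec ψ (star ψ)) := by
  have h : ∀ (x : Conf (onLattice d)) (e : Conf fun w : E => d (Sum.inr w)),
      (Equiv.sumPiEquivProdPi fun v => Fin (d v)).symm (x, e) = pairConf x e := by
    intro x e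
    ext v : 1
    cases v <;> rfl
  ext x y
  simp only [latticeState, blockTrace, Matrix.sum_apply, Matrix.submatrix_apply, Matrix.of_apply, h]
  rfl

variable [∀ v, NeZero (d v)]

lemma SupportedOn.latticeHom {A : Set Λ} {O : Op (onLattice d)} (hO : SupportedOn A O) :
    SupportedOn (Sum.inl '' A) (latticeHom d O) := by
  rw [supportedOn_iff] at hO ⊢
  simp only [latticeHom_apply]
  refine ⟨fun x y ⟨v, hv, hne⟩ => ?_, fun x y x' y' h1 h2 h3 h4 => ?_⟩
  · split_ifs with h
    · rcases v with v | w
      · exact hO.1 _ _ ⟨v, fun h => hv ⟨v, h, rfl⟩, hne⟩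
      · exact absurd (congr_fun h w) hne
    · rfl
  · rw [if_pos (funext fun w => h1 _ (by simp)), if_pos (funext fun w => h2 _ (by simp))]
    exact hO.2 _ _ _ _ (fun v hv => h1 _ (by simpa using hv)) (fun v hv => h2 _ (by simpa using hv))
      (fun v hv => h3 _ ⟨v, hv, rfl⟩) (fun v hv => h4 _ ⟨v, hv, rfl⟩)

/-- Operators supported on lattice sites come from operators on the lattice. -/
lemma exists_latticeHom_ampliate {A : Set Λ} {O : Op d} (hO : SupportedOn (Sum.inl '' A) O) :
    ∃ X : Op (sub (onLattice d) A), latticeHom d (ampliate A X) = O := by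
  rw [supportedOn_iff] at hO
  suffices h : ∃ O' : Op (onLattice d), SupportedOn A O' ∧ latticeHom d O' = O by
    obtain ⟨_, ⟨X, rfl⟩, rfl⟩ := h
    exact ⟨X, rfl⟩
  refine ⟨Matrix.of fun x y => O (pairConf x fun _ => 0) (pairConf y fun _ => 0), ?_, ?_⟩
  · rw [supportedOn_iff]
    refine ⟨fun x y ⟨v, hv, hne⟩ => hO.1 _ _ ⟨Sum.inl v, by simpa using hv, hne⟩,
      fun x y x' y' h1 h2 h3 h4 => hO.2 _ _ _ _ ?_ ?_ ?_ ?_⟩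
    · rintro (v | w) hv
      · exact h1 v (by simpa using hv)
      · rfl
    · rintro (v | w) hv
      · exact h2 v (by simpa using hv)
      · rfl
    · rintro _ ⟨v, hv, rfl⟩
      exact h3 v hv
    · rintro _ ⟨v, hv, rfl⟩
      exact h4 v hv
  · ext x y
    rw [latticeHom_apply]
    split_ifs with h
    · by_cases hA : ∀ v ∉ A, x (Sum.inl v) = y (Sum.inl v)
      · refine hO.2 _ _ _ _ ?_ ?_ ?_ ?_
        · rintro (v | w) hv
          · exact hA v (by simpa using hv)
          · rfl
        · rintro (v | w) hv
          · exact hA v (by simpa using hv)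
          · exact congr_fun h w
        · rintro _ ⟨v, hv, rfl⟩
          rfl
        · rintro _ ⟨v, hv, rfl⟩
          rfl
      · push Not at hA
        obtain ⟨v, hv, hne⟩ := hA
        rw [hO.1 x y ⟨Sum.inl v, by simpa using hv, hne⟩]
        exact hO.1 _ _ ⟨Sum.inl v, by simpa using hv, hne⟩
    · obtain ⟨w, hw⟩ := Function.ne_iff.1 h
      exact (hO.1 x y ⟨Sum.inr w, by simp, hw⟩).symm

/-- The operator `Uᴴ (O ⊗ 1) U` on the extended lattice: the Heisenberg picture of an observable `O`
of the lattice. -/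
def heisenberg (U : Matrix.unitaryGroup (Conf d) ℂ) : Op (onLattice d) →⋆ₐ[ℂ] Op d :=
  ((Unitary.conjStarAlgAut ℂ (Op d) (star U) : Op d ≃⋆ₐ[ℂ] Op d) : Op d →⋆ₐ[ℂ] Op d).comp
    (latticeHom d)

lemma heisenberg_apply (U : Matrix.unitaryGroup (Conf d) ℂ) (O : Op (onLattice d)) :
    heisenberg U O = (U : Op d)ᴴ * latticeHom d O * (U : Op d) := by
  simp [heisenberg, Matrix.star_eq_conjTranspose]

lemma heisenberg_conjTranspose (U : Matrix.unitaryGroup (Conf d) ℂ) (O : Op (onLattice d)) :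
    heisenberg U Oᴴ = (heisenberg U O)ᴴ :=
  map_star (heisenberg U) O

lemma norm_heisenberg_le (U : Matrix.unitaryGroup (Conf d) ℂ) (O : Op (onLattice d)) :
    ‖heisenberg U O‖ ≤ opNorm O :=
  NonUnitalStarAlgHom.norm_apply_le (heisenberg U) O

lemma heisenberg_injective (U : Matrix.unitaryGroup (Conf d) ℂ) :
    Function.Injective (heisenberg U) := by
  have : Nonempty (Conf fun w : E => d (Sum.inr w)) := ⟨fun _ => 0⟩
  intro O O' h
  exact blockEmbed_injective _ ((Unitary.conjStarAlgAut ℂ (Op d) (star U)).injective h)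

/-- Lattice observables have the expectation value in `U |0 ⋯ 0⟩` that their Heisenberg pictures
have in `|0 ⋯ 0⟩`. -/
lemma expectation_eq (U : Matrix.unitaryGroup (Conf d) ℂ) (O : Op (onLattice d)) :
    expectation ((U : Op d) *ᵥ zeroKet d) O = heisenberg U O 0 0 := by
  have h : Matrix.vecMulVec ((U : Op d) *ᵥ zeroKet d) (star ((U : Op d) *ᵥ zeroKet d))
      = (U : Op d) * Matrix.single 0 0 1 * (U : Op d)ᴴ := by
    rw [Matrix.star_mulVec, ← Matrix.vecMulVec_mul, ← Matrix.mul_vecMulVec]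
    congr 2
    ext x y
    have : zeroKet d = Pi.single 0 1 := rfl
    rw [this]
    by_cases hx : x = 0 <;> by_cases hy : y = 0 <;>
      simp [Matrix.vecMulVec_apply, hx, hy, eq_comm]
  rw [expectation, latticeState_eq, trace_blockTrace_mul, h, heisenberg_apply, latticeHom,
    Matrix.mul_assoc, Matrix.mul_assoc, Matrix.trace_mul_comm, Matrix.mul_assoc,
    Matrix.trace_single_mul]
  simp [Matrix.mul_assoc]

lemma latticeState_posSemidef (ψ : Conf d → ℂ) : (latticeState ψ).PosSemidef := by
  rw [latticeState_eq]
  exact blockTrace_posSemidef _ (Matrix.posSemidef_vecMulVec_self_star ψ)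

variable {G : SimpleGraph Λ} {G' : SimpleGraph (Λ ⊕ E)} {D : ℕ}

lemma SupportedOn.heisenberg {U : Matrix.unitaryGroup (Conf d) ℂ}
    (hU : IsLocalCircuit G' D (U : Op d)) {A : Set Λ} {O : Op (onLattice d)}
    (hO : SupportedOn A O) : SupportedOn (thicken G' (Sum.inl '' A) D) (heisenberg U O) := by
  have h := hU.conjTranspose.supportedOn_conj hO.latticeHom
  rwa [Matrix.conjTranspose_conjTranspose, ← heisenberg_apply] at h

/-- Away from the ancillas, the projectors that stabilize the state are lattice observables on
slightly larger discs. -/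
lemma exists_heisenberg_eq_vacProj (hG : G'.comap Sum.inl = G) {U : Matrix.unitaryGroup (Conf d) ℂ}
    (hU : IsLocalCircuit G' D (U : Op d)) {c : Λ} {s r : ℕ}
    (hr : disc G' (Sum.inl c) r ⊆ Set.range Sum.inl) (hs : s + D ≤ r) :
    ∃ X : Op (sub (onLattice d) (disc G c (s + D))),
      heisenberg U (ampliate _ X) = vacProj d (Sum.inl '' disc G c s) := by
  have h := (hU.supportedOn_conj (supportedOn_vacProj (d := d) (Sum.inl '' disc G c s))).mono
    (thicken_image_disc_subset hG hr hs)
  obtain ⟨X, hX⟩ := exists_latticeHom_ampliate h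
  have hUU : (U : Op d)ᴴ * (U : Op d) = 1 := Matrix.mem_unitaryGroup_iff'.1 U.2
  refine ⟨X, ?_⟩
  rw [heisenberg_apply, hX]
  calc (U : Op d)ᴴ * ((U : Op d) * vacProj d (Sum.inl '' disc G c s) * (U : Op d)ᴴ) * (U : Op d)
      = ((U : Op d)ᴴ * (U : Op d)) * vacProj d (Sum.inl '' disc G c s) *
          ((U : Op d)ᴴ * (U : Op d)) := by simp only [Matrix.mul_assoc]
    _ = _ := by rw [hUU, one_mul, mul_one]

/-- Local invisibility of `Q`, in the Heisenberg picture: if `K` acts far from a disc, then `Q K`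
takes the product state to one with weight at most `δ²` outside `|0 ⋯ 0⟩` on the disc. -/
lemma IsApproxLocallyInvisible.vacNorm_le (hG : G'.comap Sum.inl = G)
    {U : Matrix.unitaryGroup (Conf d) ℂ} (hU : IsLocalCircuit G' D (U : Op d))
    {δ : ℝ} (hδ : 0 ≤ δ) {r t : ℕ} {Q : Op (onLattice d)}
    (hQinv : IsApproxLocallyInvisible G δ r t (latticeState ((U : Op d) *ᵥ zeroKet d)) Q)
    (hQu : Qᴴ * Q = 1) {c : Λ} {s : ℕ} (hs : s + D ≤ r)
    (hc : disc G' (Sum.inl c) (s + t + 3 * D) ⊆ Set.range Sum.inl)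
    {K : Op (onLattice d)} {Y : Set (Λ ⊕ E)} (hK : SupportedOn Y (heisenberg U K))
    (hY : Disjoint (Sum.inl '' disc G c (s + t + 2 * D)) Y) :
    vacNorm ((1 - vacProj d (Sum.inl '' disc G c s)) * (heisenberg U Q * heisenberg U K))
      ≤ δ * vacNorm (heisenberg U K) := by
  classical
  set ρ := latticeState ((U : Op d) *ᵥ zeroKet d) with hρ
  set k := vacNorm (heisenberg U K) with hk
  have hρtr : ∀ O, (ρ * O).trace = heisenberg U O 0 0 := expectation_eq U
  obtain ⟨X, hX⟩ := exists_heisenberg_eq_vacProj hG hU (s := s) hc (by omega)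
  set Z := vacProj d (Sum.inl '' disc G c s) with hZ
  set W := (1 - Z) * (heisenberg U Q * heisenberg U K) with hW
  have hZh : (1 - Z)ᴴ * (1 - Z) = 1 - Z := by
    rw [Matrix.conjTranspose_sub, Matrix.conjTranspose_one, hZ, vacProj_conjTranspose]
    exact IsIdempotentElem.one_sub (vacProj_mul_self _)
  rcases (vacNorm_nonneg (heisenberg U K)).eq_or_lt with h0 | hpos
  · have h1 := vacNorm_mul_le ((1 - Z) * heisenberg U Q) (heisenberg U K)
    rw [← h0, mul_zero, Matrix.mul_assoc] at h1
    rw [hk, ← h0, mul_zero]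
    exact h1
  rw [← hk] at hpos
  have hk2 : ((heisenberg U (Kᴴ * K)) 0 0) = ((k ^ 2 : ℝ) : ℂ) := by
    rw [map_mul, heisenberg_conjTranspose, hk, vacNorm_sq]
    refine (Complex.conj_eq_iff_re.1 ?_).symm
    have : ((heisenberg U K)ᴴ * heisenberg U K)ᴴ = (heisenberg U K)ᴴ * heisenberg U K := by
      simp [Matrix.conjTranspose_mul]
    exact congr_fun₂ this 0 0
  have hkne : ((k ^ 2 : ℝ) : ℂ) ≠ 0 := by exact_mod_cast (pow_pos hpos 2).ne'
  -- the normalized state `K ρ Kᴴ` to which the hypothesis on `Q` is applied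
  set ρ' : Op (onLattice d) := ((k ^ 2 : ℝ) : ℂ)⁻¹ • (K * ρ * Kᴴ) with hρ'
  have htr : ∀ O, (ρ' * O).trace = ((k ^ 2 : ℝ) : ℂ)⁻¹ * heisenberg U (Kᴴ * O * K) 0 0 := by
    intro O
    rw [← hρtr, hρ', Matrix.smul_mul, Matrix.trace_smul, smul_eq_mul]
    congr 1
    calc (K * ρ * Kᴴ * O).trace = (K * (ρ * (Kᴴ * O))).trace := by simp only [Matrix.mul_assoc]
      _ = _ := by rw [Matrix.trace_mul_comm]; simp only [Matrix.mul_assoc]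
  have hρ's : IsState ρ' := by
    refine ⟨?_, ?_⟩
    · refine ((latticeState_posSemidef _).mul_mul_conjTranspose_same K).smul ?_
      rw [← Complex.ofReal_inv]
      exact_mod_cast (inv_pos.2 (pow_pos hpos 2)).le
    · have := htr 1
      rwa [mul_one, mul_one, hk2, inv_mul_cancel₀ hkne] at this
  have hρs : IsState ρ := by
    refine ⟨latticeState_posSemidef _, ?_⟩
    have := hρtr 1
    rwa [mul_one, map_one, Matrix.one_apply_eq] at this
  have hmarg : marginal (thicken G (disc G c (s + D)) t) ρ'
      = marginal (thicken G (disc G c (s + D)) t) ρ := by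
    refine marginal_eq_of_forall_trace fun O => ?_
    have hsub : thicken G (disc G c (s + D)) t ⊆ disc G c (s + t + D) := by
      rintro u ⟨v, hv, hu⟩
      have := edist_le_add hv hu
      rwa [show s + D + t = s + t + D by ring] at this
    have hO : SupportedOn (Sum.inl '' disc G c (s + t + 2 * D))
        (heisenberg U (ampliate (thicken G (disc G c (s + D)) t) O)) := by
      have h1 : SupportedOn (disc G c (s + t + D))
          (ampliate (thicken G (disc G c (s + D)) t) O) :=
        SupportedOn.mono ⟨O, rfl⟩ hsub
      refine (h1.heisenberg hU).mono ?_
      have := thicken_image_disc_subset hG hc (a := s + t + D) (b := D) (by omega)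
      rwa [show s + t + D + D = s + t + 2 * D by ring] at this
    set B := ampliate (thicken G (disc G c (s + D)) t) O
    rw [htr, hρtr]
    have e : heisenberg U (Kᴴ * B * K) = heisenberg U (Kᴴ * K) * heisenberg U B := by
      rw [map_mul, map_mul, map_mul, Matrix.mul_assoc, hO.mul_comm hK hY, Matrix.mul_assoc]
    have hKK : SupportedOn Y (heisenberg U (Kᴴ * K)) := by
      rw [map_mul, heisenberg_conjTranspose]
      exact hK.conjTranspose.mul hK
    rw [e, apply_zero_mul_of_disjoint hKK hO hY.symm, hk2, inv_mul_cancel_left₀ hkne]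
  have hdist := hQinv c (s + D) t hs le_rfl ρ' hρ's hmarg
  have hQtr : ∀ O, (Q * ρ' * Qᴴ * O).trace
      = ((k ^ 2 : ℝ) : ℂ)⁻¹ * heisenberg U (Kᴴ * (Qᴴ * O * Q) * K) 0 0 := by
    intro O
    rw [← htr]
    calc (Q * ρ' * Qᴴ * O).trace = (Q * (ρ' * (Qᴴ * O))).trace := by simp only [Matrix.mul_assoc]
      _ = _ := by rw [Matrix.trace_mul_comm]; simp only [Matrix.mul_assoc]
  have hQs : IsState (Q * ρ' * Qᴴ) := by
    refine ⟨hρ's.1.mul_mul_conjTranspose_same Q, ?_⟩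
    rw [Matrix.trace_mul_comm, ← Matrix.mul_assoc, hQu, one_mul, hρ's.2]
  rw [hQs.2, inv_one, one_smul] at hdist
  have hinj : Function.Injective fun O : Op (sub (onLattice d) (disc G c (s + D))) =>
      heisenberg U (ampliate _ O) := by
    have : Nonempty (∀ v : {v // ¬ v ∈ disc G c (s + D)}, Fin (onLattice d v)) := ⟨fun _ => 0⟩
    intro O O' h
    have h' := heisenberg_injective U h
    rw [← ampliateHom_apply, ← ampliateHom_apply] at h'
    exact blockEmbed_injective _ h'
  have hXh : Xᴴ = X := hinj <| by
    have : ampliate (disc G c (s + D)) Xᴴ = (ampliate (disc G c (s + D)) X)ᴴ := by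
      rw [← ampliateHom_apply, ← ampliateHom_apply]
      exact map_star (ampliateHom _ _) X
    change heisenberg U (ampliate (disc G c (s + D)) Xᴴ) = _
    rw [this, heisenberg_conjTranspose, hX, vacProj_conjTranspose]
    exact hX.symm
  have hXX : X * X = X := hinj <| by
    change heisenberg U (ampliate (disc G c (s + D)) (X * X)) = heisenberg U (ampliate _ X)
    rw [← ampliateHom_apply, map_mul, map_mul, ampliateHom_apply, hX, vacProj_mul_self]
  have hρX : (marginal (disc G c (s + D)) ρ * X).trace = 1 := by
    rw [trace_marginal_mul, hρtr, hX]
    simpa using mul_vacProj_apply_zero (1 : Op d) (Sum.inl '' disc G c s) 0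
  have hfin := trace_mul_one_sub_le_of_purifiedDistance_le (marginal_isState _ hρs)
    (marginal_isState _ hQs) hXh hXX hρX (by convert hdist)
  have hamp : ampliate (disc G c (s + D)) (1 - X) = 1 - ampliate (disc G c (s + D)) X := by
    simp only [← ampliateHom_apply, map_sub, map_one]
  have e : heisenberg U (Kᴴ * (Qᴴ * (1 - ampliate (disc G c (s + D)) X) * Q) * K) = Wᴴ * W := by
    simp only [map_mul, map_sub, map_one, heisenberg_conjTranspose, hX]
    rw [hW, Matrix.conjTranspose_mul, Matrix.conjTranspose_mul]
    calc (heisenberg U K)ᴴ * ((heisenberg U Q)ᴴ * (1 - Z) * heisenberg U Q) * heisenberg U K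
        = (heisenberg U K)ᴴ * (heisenberg U Q)ᴴ * ((1 - Z)) *
          (heisenberg U Q * heisenberg U K) := by simp only [Matrix.mul_assoc]
      _ = (heisenberg U K)ᴴ * (heisenberg U Q)ᴴ * ((1 - Z)ᴴ * (1 - Z)) *
          (heisenberg U Q * heisenberg U K) := by rw [hZh]
      _ = _ := by simp only [Matrix.mul_assoc]
  rw [trace_marginal_mul, hamp, hQtr, e, ← Complex.ofReal_inv, Complex.re_ofReal_mul,
    ← vacNorm_sq, inv_mul_le_iff₀ (pow_pos hpos 2)] at hfin
  refine (sq_le_sq₀ (vacNorm_nonneg _) (mul_nonneg hδ hpos.le)).1 ?_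
  linarith [mul_pow δ k 2]

end Frame

/-! ### The twist product -/

section Twist

open scoped Matrix.Norms.L2Operator

variable {V : Type*} [Fintype V] [DecidableEq V] {d : V → ℕ} [∀ v, NeZero (d v)] {M : Set V}
  {P Q : Op d}

lemma CutDecomposition.inner_outer_comm (p : CutDecomposition M P) (q : CutDecomposition M Q)
    (j : Fin p.num) (k : Fin q.num) : p.inner j * q.outer k = q.outer k * p.inner j :=
  (p.inner_supported j).mul_comm (q.outer_supported k) disjoint_compl_right

/-- The twist product depends on its second factor only through the operator. -/
lemma CutDecomposition.twist_eq_sum_outer_mul (p : CutDecomposition M P)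
    (q : CutDecomposition M Q) : p.twist q = ∑ j, p.outer j * Q * p.inner j := by
  refine Finset.sum_congr rfl fun j _ => ?_
  conv_rhs => rw [← q.sum_eq, Finset.mul_sum, Finset.sum_mul]
  refine Finset.sum_congr rfl fun k _ => ?_
  rw [q.inner_outer_comm q]
  simp only [Matrix.mul_assoc]

/-- The twist product depends on its first factor only through the operator. -/
lemma CutDecomposition.twist_eq_sum_inner_mul (p : CutDecomposition M P)
    (q : CutDecomposition M Q) : p.twist q = ∑ k, q.inner k * P * q.outer k := by
  rw [CutDecomposition.twist, Finset.sum_comm]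
  refine Finset.sum_congr rfl fun k _ => ?_
  conv_rhs => rw [← p.sum_eq, Finset.mul_sum, Finset.sum_mul]
  refine Finset.sum_congr rfl fun j _ => ?_
  calc p.outer j * q.outer k * (q.inner k * p.inner j)
      = p.outer j * (q.inner k * q.outer k) * p.inner j := by
        rw [q.inner_outer_comm q]; simp only [Matrix.mul_assoc]
    _ = (q.inner k * p.outer j) * (p.inner j * q.outer k) := by
        rw [q.inner_outer_comm p, p.inner_outer_comm q]; simp only [Matrix.mul_assoc]
    _ = q.inner k * (p.inner j * p.outer j) * q.outer k := by
        rw [p.inner_outer_comm p, p.inner_outer_comm q]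
        simp only [Matrix.mul_assoc]
        rw [p.inner_outer_comm q]

/-- A decomposition can be restricted to the support of the operator without increasing `alpha`. -/
lemma CutDecomposition.exists_restrict {s : Set V} (hP : SupportedOn s P)
    (p : CutDecomposition M P) : ∃ p' : CutDecomposition M P,
      (∀ j, SupportedOn (s ∩ M) (p'.inner j)) ∧ (∀ j, SupportedOn (s ∩ Mᶜ) (p'.outer j)) ∧
      p'.alpha ≤ p.alpha := by
  refine ⟨⟨p.num, fun j => slice s (p.inner j), fun j => slice s (p.outer j),
    fun j => (p.inner_supported j).slice.mono Set.inter_subset_right,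
    fun j => (p.outer_supported j).slice.mono Set.inter_subset_right, ?_⟩,
    fun j => (p.inner_supported j).slice, fun j => (p.outer_supported j).slice, ?_⟩
  · conv_rhs => rw [← slice_eq_self hP, ← p.sum_eq, slice_sum]
    exact Finset.sum_congr rfl fun j _ =>
      (slice_mul (p.inner_supported j) (p.outer_supported j) disjoint_compl_right).symm
  · refine Finset.sum_le_sum fun j _ => ?_
    exact mul_le_mul (norm_slice_le s _) (norm_slice_le s _) (norm_nonneg _) (norm_nonneg _)

/-- The estimate behind the theorem, in the Heisenberg picture.  The projector onto the product
state on a region `R` can be inserted to the left of `Q`, moved through the decompositions, and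
absorbed on the right once `P` has been replaced by its expectation value. -/
lemma norm_twist_sub_le {ι κ : Type*} [Fintype ι] [Fintype κ] {Pi Po : ι → Op d} {Qi Qo : κ → Op d}
    (hP : ∑ j, Pi j * Po j = P) (hQ : ∑ k, Qi k * Qo k = Q)
    (hPP : ∀ j, Pi j * Po j = Po j * Pi j) (hPQ : ∀ j k, Pi j * Qo k = Qo k * Pi j)
    (hQP : ∀ j k, Qi k * Po j = Po j * Qi k) {R : Set V}
    (hPR : ∀ j, Pi j * vacProj d R = vacProj d R * Pi j)
    (hQR : ∀ k, Qi k * vacProj d R = vacProj d R * Qi k) {ε ε' : ℝ}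
    (hε : ∀ j, vacNorm ((1 - vacProj d R) * (Q * Pi j)) ≤ ε * ‖Pi j‖)
    (hε' : ∀ k, vacNorm ((P - P 0 0 • 1) * (vacProj d R * Qo k)) ≤ ε' * ‖Qo k‖) :
    ‖(∑ j, Po j * Q * Pi j) 0 0 - P 0 0 * Q 0 0‖ ≤
      ε * (∑ j, ‖Pi j‖ * ‖Po j‖) + ε' * ∑ k, ‖Qi k‖ * ‖Qo k‖ := by
  set Z := vacProj d R with hZ
  have hswap : ∑ j, Po j * (Z * (Q * Pi j)) = ∑ k, Qi k * (P * (Z * Qo k)) := by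
    simp only [← hP, ← hQ, Finset.sum_mul, Finset.mul_sum]
    rw [Finset.sum_comm]
    refine Finset.sum_congr rfl fun k _ => Finset.sum_congr rfl fun j _ => ?_
    calc Po j * (Z * (Qi k * Qo k * Pi j)) = Po j * (Z * Qi k) * (Qo k * Pi j) := by
          simp only [Matrix.mul_assoc]
      _ = (Po j * Qi k) * (Z * Pi j) * Qo k := by
          rw [← hQR, ← hPQ]; simp only [Matrix.mul_assoc]
      _ = Qi k * (Po j * Pi j) * (Z * Qo k) := by
          rw [← hQP, ← hPR]; simp only [Matrix.mul_assoc]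
      _ = Qi k * (Pi j * Po j * (Z * Qo k)) := by rw [hPP]; simp only [Matrix.mul_assoc]
  have hZQ : ∑ k, Qi k * (Z * Qo k) = Z * Q := by
    rw [← hQ, Finset.mul_sum]
    exact Finset.sum_congr rfl fun k _ => by rw [← Matrix.mul_assoc, hQR, Matrix.mul_assoc]
  have hsplit : ∑ j, Po j * Q * Pi j = ∑ j, Po j * ((1 - Z) * (Q * Pi j))
      + (∑ k, Qi k * ((P - P 0 0 • 1) * (Z * Qo k)) + P 0 0 • (Z * Q)) := by
    have h1 : ∀ k, Qi k * ((P - P 0 0 • 1) * (Z * Qo k))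
        = Qi k * (P * (Z * Qo k)) - P 0 0 • (Qi k * (Z * Qo k)) := fun k => by
      rw [sub_mul, mul_sub, Matrix.smul_mul, one_mul, Matrix.mul_smul]
    have h2 : ∀ j, Po j * ((1 - Z) * (Q * Pi j)) = Po j * Q * Pi j - Po j * (Z * (Q * Pi j)) :=
      fun j => by rw [sub_mul, mul_sub, one_mul, Matrix.mul_assoc]
    simp only [h1, h2, Finset.sum_sub_distrib, ← Finset.smul_sum, hZQ, hswap]
    abel
  have hentry : (∑ j, Po j * Q * Pi j) 0 0 - P 0 0 * Q 0 0
      = (∑ j, (Po j * ((1 - Z) * (Q * Pi j))) 0 0)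
        + ∑ k, (Qi k * ((P - P 0 0 • 1) * (Z * Qo k))) 0 0 := by
    rw [hsplit, Matrix.add_apply, Matrix.add_apply, Matrix.smul_apply, smul_eq_mul, hZ,
      vacProj_mul_apply_zero, Matrix.sum_apply, Matrix.sum_apply]
    ring
  rw [hentry, Finset.mul_sum, Finset.mul_sum]
  refine (norm_add_le _ _).trans (add_le_add ?_ ?_)
  · refine (norm_sum_le _ _).trans (Finset.sum_le_sum fun j _ => ?_)
    calc _ ≤ ‖Po j‖ * vacNorm ((1 - Z) * (Q * Pi j)) :=
          (norm_apply_zero_le _).trans (vacNorm_mul_le _ _)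
      _ ≤ ‖Po j‖ * (ε * ‖Pi j‖) := by gcongr; exact hε j
      _ = _ := by ring
  · refine (norm_sum_le _ _).trans (Finset.sum_le_sum fun k _ => ?_)
    calc _ ≤ ‖Qi k‖ * vacNorm ((P - P 0 0 • 1) * (Z * Qo k)) :=
          (norm_apply_zero_le _).trans (vacNorm_mul_le _ _)
      _ ≤ ‖Qi k‖ * (ε' * ‖Qo k‖) := by gcongr; exact hε' k
      _ = _ := by ring

/-- If `X` leaves the product state unchanged on its support up to `ε`, then it acts as the scalar
`X 0 0` up to `ε` on all vectors that are `|0⟩` on its support. -/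
lemma vacNorm_sub_smul_mul_le {T : Set V} {X : Op d} (hX : SupportedOn T X) {ε : ℝ}
    (h : vacNorm ((1 - vacProj d T) * X) ≤ ε) (Y : Op d) :
    vacNorm ((X - X 0 0 • 1) * (vacProj d T * Y)) ≤ ε * vacNorm (vacProj d T * Y) := by
  have hsupp : SupportedOn T (X - X 0 0 • 1) := hX.sub ((supportedOn_one T).smul _)
  rw [vacNorm_mul_vacProj_mul hsupp]
  refine mul_le_mul_of_nonneg_right (le_trans (le_of_eq ?_) h) (vacNorm_nonneg _)
  refine vacNorm_congr fun x => ?_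
  have h1 : (vacProj d T * X) x 0 = X 0 0 * (1 : Op d) x 0 := by
    rw [← mul_vacProj_apply_zero (vacProj d T * X) T, vacProj_mul_mul_vacProj hX,
      Matrix.smul_apply, smul_eq_mul, ← mul_vacProj_apply_zero 1 T, one_mul]
  rw [sub_mul, one_mul, Matrix.sub_apply, Matrix.sub_apply, h1, Matrix.smul_apply, smul_eq_mul]

/-- Let `X` leave the product state unchanged on its support `T` up to `ε`, and let `T` be covered by
a region `R` where a vector has been projected onto the product state and a region `R'` that `Y`
does not touch.  Then `X` acts as a scalar on the projection of `Y |0 ⋯ 0⟩`. -/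
lemma vacNorm_sub_smul_mul_vacProj_mul_le {T R R' : Set V} {X Y : Op d} (hX : SupportedOn T X)
    {ε : ℝ} (h : vacNorm ((1 - vacProj d T) * X) ≤ ε) (hT : T ⊆ R ∪ R')
    (hY : Y * vacProj d R' = vacProj d R' * Y) :
    vacNorm ((X - X 0 0 • 1) * (vacProj d R * Y)) ≤ ε * ‖Y‖ := by
  have habs : vacProj d R * Y * vacProj d R' = vacProj d T * (vacProj d (R ∪ R') * Y) := by
    rw [← mul_assoc (vacProj d T), vacProj_mul, Set.union_eq_self_of_subset_left hT, mul_assoc, hY,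
      ← mul_assoc, vacProj_mul]
  have hcol : vacNorm ((X - X 0 0 • 1) * (vacProj d R * Y))
      = vacNorm ((X - X 0 0 • 1) * (vacProj d T * (vacProj d (R ∪ R') * Y))) := by
    rw [← habs, ← mul_assoc (X - X 0 0 • 1) _ (vacProj d R')]
    exact vacNorm_congr fun x => (mul_vacProj_apply_zero _ _ x).symm
  rw [hcol]
  refine (vacNorm_sub_smul_mul_le hX h _).trans
    (mul_le_mul_of_nonneg_left ?_ ((vacNorm_nonneg _).trans h))
  rw [← mul_assoc, vacProj_mul]
  exact (vacNorm_mul_le _ _).trans ((mul_le_of_le_one_left (vacNorm_nonneg _)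
    (norm_vacProj_le _)).trans (vacNorm_le_norm _))

lemma CutDecomposition.alpha_nonneg (p : CutDecomposition M P) : 0 ≤ p.alpha :=
  Finset.sum_nonneg fun _ _ => mul_nonneg (norm_nonneg _) (norm_nonneg _)

end Twist

/-! ### Discs, light cones and the twist product together -/

section Lattice

open scoped Matrix.Norms.L2Operator

/-- The bound for the twist product, with the constant that the argument gives: the discs `c'` that
reach `X₂` form the region where the projector is inserted, and the discs `c` cover the light cone
of `P`. -/
lemma norm_expectation_twist_sub_le {Λ E : Type*} [Fintype Λ] [DecidableEq Λ] [Fintype E] [DecidableEq E]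
    (G : SimpleGraph Λ) (G' : SimpleGraph (Λ ⊕ E)) (hG : G'.comap Sum.inl = G)
    (d : Λ ⊕ E → ℕ) [∀ v, NeZero (d v)]
    (D : ℕ) (U : Op d) (hU : IsLocalCircuit G' D U)
    (ψ : Conf d → ℂ) (hψ : ψ = U *ᵥ zeroKet d)
    (δ : ℝ) (hδ₀ : 0 ≤ δ) (r t : ℕ)
    (P Q : Op (onLattice d))
    (hP : IsLocalCircuit G t P) (hQ : IsLocalCircuit G t Q)
    (hPinv : IsApproxLocallyInvisible G δ r t (latticeState ψ) P)
    (hQinv : IsApproxLocallyInvisible G δ r t (latticeState ψ) Q)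
    (p q : Set Λ) (hp : SupportedOn p P) (hq : SupportedOn q Q)
    (M X₂ : Set Λ)
    (kP : ℕ) (c : Fin kP → Λ) (rad : Fin kP → ℕ) (hrad : ∀ j, rad j + D ≤ r)
    (hcover : thicken G p D ⊆ ⋃ j, disc G (c j) (rad j))
    (hcΛ : ∀ j, disc G' (Sum.inl (c j)) (rad j + t + 3 * D) ⊆ Set.range Sum.inl)
    (m : ℕ) (c' : Fin m → Λ) (rad' : Fin m → ℕ) (hrad' : ∀ i, rad' i + D ≤ r)
    (hcover' : (⋃ j, disc G (c j) (rad j + t + 2 * D)) ⊆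
      ⋃ i, disc G (c' i) (rad' i))
    (hcΛ' : ∀ i, disc G' (Sum.inl (c' i)) (rad' i + t + 3 * D) ⊆ Set.range Sum.inl)
    (hside : ∀ i, disc G (c' i) (rad' i + D) ∩ q ⊆ M ∨
      (disc G (c' i) (rad' i + D) ∩ q ⊆ Mᶜ ∧
        (disc G (c' i) (rad' i + D) ∩ X₂).Nonempty))
    (dsep : ℕ) (hdsep : ∀ u ∈ p ∩ M, ∀ v ∈ X₂, (dsep : ℕ∞) ≤ G.edist u v)
    (hsep : ∀ i, 2 * (rad' i + t + 3 * D) < dsep)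
    (kQ : ℕ)
    (hkQ : {i | (disc G (c' i) (rad' i + D) ∩ X₂).Nonempty}.ncard ≤ kQ)
    (decP : CutDecomposition M P) (decQ : CutDecomposition M Q) :
    ‖expectation ψ (decP.twist decQ) -
        expectation ψ P * expectation ψ Q‖ ≤
      δ * (decP.alpha * kQ + decQ.alpha * kP) := by
  classical
  subst hψ
  set u : Matrix.unitaryGroup (Conf d) ℂ := ⟨U, hU.mem_unitaryGroup⟩ with hu
  have hU' : IsLocalCircuit G' D (u : Op d) := hU
  have hPu : Pᴴ * P = 1 := Matrix.mem_unitaryGroup_iff'.1 hP.mem_unitaryGroup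
  have hQu : Qᴴ * Q = 1 := Matrix.mem_unitaryGroup_iff'.1 hQ.mem_unitaryGroup
  obtain ⟨dP, hdPi, hdPo, hdPα⟩ := decP.exists_restrict hp
  obtain ⟨dQ, hdQi, hdQo, hdQα⟩ := decQ.exists_restrict hq
  have htwist : decP.twist decQ = ∑ j, dP.outer j * Q * dP.inner j := by
    rw [decP.twist_eq_sum_inner_mul, ← dP.twist_eq_sum_inner_mul decQ, dP.twist_eq_sum_outer_mul]
  -- the discs at the crossing `X₂`, on which `Q` acts only outside `M`
  set I : Finset (Fin m) := Finset.univ.filter fun i =>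
    disc G (c' i) (rad' i + D) ∩ q ⊆ Mᶜ ∧ (disc G (c' i) (rad' i + D) ∩ X₂).Nonempty with hI
  have hIsub : (I : Set (Fin m)) ⊆ {i | (disc G (c' i) (rad' i + D) ∩ X₂).Nonempty} :=
    fun i hi => (Finset.mem_filter.1 (Finset.mem_coe.1 hi)).2.2
  have hIcard : (I.card : ℝ) ≤ kQ := by
    rw [← Set.ncard_coe_finset]
    exact_mod_cast (Set.ncard_le_ncard hIsub (Set.toFinite _)).trans hkQ
  set S : Fin m → Set (Λ ⊕ E) := fun i => Sum.inl '' disc G (c' i) (rad' i) with hS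
  set T : Fin kP → Set (Λ ⊕ E) := fun j => Sum.inl '' disc G (c j) (rad j) with hT
  set R : Set (Λ ⊕ E) := ⋃ i ∈ I, S i with hR
  set R' : Set (Λ ⊕ E) := ⋃ i ∈ Finset.univ.filter (· ∉ I), S i with hR'
  -- geometry: which discs meet the light cones of which operators
  have hfar : ∀ i ∈ I, Disjoint (Sum.inl '' disc G (c' i) (rad' i + t + 2 * D))
      (thicken G' (Sum.inl '' (p ∩ M)) D) := by
    intro i hi
    refine disjoint_image_disc_thicken hG (hcΛ' i) (by omega) fun v hv w hw hd => ?_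
    obtain ⟨x, hx, hxX⟩ := (Finset.mem_filter.1 hi).2.2
    have h1 : G.edist x (c' i) ≤ (rad' i + D : ℕ) := by rw [SimpleGraph.edist_comm]; exact hx
    have h2 := edist_le_add (edist_le_add h1 hw) hd
    rw [SimpleGraph.edist_comm] at h2
    have h3 := (hdsep v hv x hxX).trans h2
    have h4 : dsep ≤ rad' i + D + (rad' i + t + 2 * D) + D := by exact_mod_cast h3
    have := hsep i
    omega
  have hPR : Disjoint R (thicken G' (Sum.inl '' (p ∩ M)) D) := by
    rw [hR, Set.disjoint_iUnion₂_left]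
    exact fun i hi => (hfar i hi).mono_left (Set.image_mono (disc_mono _ (by omega)))
  have hside' : ∀ i (Y : Set Λ), Disjoint (disc G (c' i) (rad' i + D)) Y →
      Disjoint (S i) (thicken G' (Sum.inl '' Y) D) := by
    intro i Y hd
    refine disjoint_image_disc_thicken hG (hcΛ' i) (by omega) fun v hv w hw hwv => ?_
    exact Set.disjoint_left.1 hd (edist_le_add hw hwv) hv
  have hQR : Disjoint R (thicken G' (Sum.inl '' (q ∩ M)) D) := by
    rw [hR, Set.disjoint_iUnion₂_left]
    refine fun i hi => hside' i _ (Set.disjoint_left.2 fun x hx hxq => ?_)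
    exact (Finset.mem_filter.1 hi).2.1 ⟨hx, hxq.1⟩ hxq.2
  have hQR' : Disjoint R' (thicken G' (Sum.inl '' (q ∩ Mᶜ)) D) := by
    rw [hR', Set.disjoint_iUnion₂_left]
    refine fun i hi => hside' i _ (Set.disjoint_left.2 fun x hx hxq => ?_)
    refine hxq.2 ((hside i).resolve_right (fun h => ?_) ⟨hx, hxq.1⟩)
    exact (Finset.mem_filter.1 hi).2 (Finset.mem_filter.2 ⟨Finset.mem_univ i, h⟩)
  have hPT : thicken G' (Sum.inl '' p) D ⊆ ⋃ j ∈ Finset.univ, T j := by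
    rintro w ⟨_, ⟨v, hv, rfl⟩, hw⟩
    obtain ⟨j, hj⟩ := Set.mem_iUnion.1 (hcover (subset_thicken p D hv))
    obtain ⟨w', rfl, hvw⟩ := exists_edist_le_of_mem_disc hG (hcΛ j) (by omega) hj hw
    obtain ⟨j', hj'⟩ := Set.mem_iUnion.1 (hcover ⟨v, hv, hvw⟩)
    exact Set.mem_biUnion (Finset.mem_univ j') ⟨w', hj', rfl⟩
  have hTR : (⋃ j ∈ Finset.univ, T j) ⊆ R ∪ R' := by
    refine Set.iUnion₂_subset fun j _ => ?_
    rintro _ ⟨w, hw, rfl⟩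
    have hw' : w ∈ disc G (c j) (rad j + t + 2 * D) :=
      disc_mono _ (by omega) hw
    obtain ⟨i, hi⟩ := Set.mem_iUnion.1 (hcover' (Set.mem_iUnion.2 ⟨j, hw'⟩))
    by_cases hiI : i ∈ I
    · exact Or.inl (Set.mem_biUnion hiI ⟨w, hi, rfl⟩)
    · exact Or.inr (Set.mem_biUnion (Finset.mem_filter.2 ⟨Finset.mem_univ i, hiI⟩) ⟨w, hi, rfl⟩)
  -- local invisibility of `Q` on the states `P_M^j |ψ⟩`, at the discs near `X₂`
  have hε : ∀ j, vacNorm ((1 - vacProj d R) * (heisenberg u Q * heisenberg u (dP.inner j))) ≤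
      kQ * δ * ‖heisenberg u (dP.inner j)‖ := by
    intro j
    have h := vacNorm_one_sub_vacProj_biUnion_le I S
      (heisenberg u Q * heisenberg u (dP.inner j)) fun i hi =>
        hQinv.vacNorm_le hG hU' hδ₀ hQu (hrad' i) (hcΛ' i) ((hdPi j).heisenberg hU') (hfar i hi)
    refine h.trans ?_
    rw [← mul_assoc]
    exact mul_le_mul (mul_le_mul_of_nonneg_right hIcard hδ₀) (vacNorm_le_norm _) (vacNorm_nonneg _)
      (mul_nonneg (Nat.cast_nonneg _) hδ₀)
  -- local invisibility of `P` on the state itself, at the discs that cover its light cone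
  have hPε : vacNorm ((1 - vacProj d (⋃ j ∈ Finset.univ, T j)) * heisenberg u P) ≤ kP * δ := by
    have h := vacNorm_one_sub_vacProj_biUnion_le Finset.univ T (heisenberg u P) fun j _ => by
      have h1 : SupportedOn ∅ (heisenberg u (1 : Op (onLattice d))) := by
        rw [map_one]; exact supportedOn_one ∅
      have := hPinv.vacNorm_le hG hU' hδ₀ hPu (hrad j) (hcΛ j) h1 (Set.disjoint_empty _)
      rwa [map_one, mul_one, vacNorm_one, mul_one] at this
    rwa [Finset.card_univ, Fintype.card_fin] at h
  have hPT' : SupportedOn (⋃ j ∈ Finset.univ, T j) (heisenberg u P) :=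
    (hp.heisenberg hU').mono hPT
  have hε' : ∀ k, vacNorm ((heisenberg u P - heisenberg u P 0 0 • 1) *
      (vacProj d R * heisenberg u (dQ.outer k))) ≤ kP * δ * ‖heisenberg u (dQ.outer k)‖ := by
    intro k
    exact vacNorm_sub_smul_mul_vacProj_mul_le hPT' hPε hTR
      (((hdQo k).heisenberg hU').mul_comm (supportedOn_vacProj R') hQR'.symm)
  have hcomm : ∀ {X Y : Op (onLattice d)}, X * Y = Y * X →
      heisenberg u X * heisenberg u Y = heisenberg u Y * heisenberg u X := fun h => by
    rw [← map_mul, h, map_mul]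
  have hPsum : ∑ j, heisenberg u (dP.inner j) * heisenberg u (dP.outer j) = heisenberg u P := by
    simp only [← map_mul, ← map_sum, dP.sum_eq]
  have hQsum : ∑ k, heisenberg u (dQ.inner k) * heisenberg u (dQ.outer k) = heisenberg u Q := by
    simp only [← map_mul, ← map_sum, dQ.sum_eq]
  have hmain := norm_twist_sub_le (P := heisenberg u P) (Q := heisenberg u Q)
    (Pi := fun j => heisenberg u (dP.inner j)) (Po := fun j => heisenberg u (dP.outer j))
    (Qi := fun k => heisenberg u (dQ.inner k)) (Qo := fun k => heisenberg u (dQ.outer k))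
    hPsum hQsum
    (fun j => hcomm (dP.inner_outer_comm dP j j)) (fun j k => hcomm (dP.inner_outer_comm dQ j k))
    (fun j k => hcomm (dQ.inner_outer_comm dP k j))
    (fun j => ((hdPi j).heisenberg hU').mul_comm (supportedOn_vacProj R) hPR.symm)
    (fun k => ((hdQi k).heisenberg hU').mul_comm (supportedOn_vacProj R) hQR.symm) hε hε'
  have hα : ∀ {O : Op (onLattice d)} (p : CutDecomposition M O),
      ∑ j, ‖heisenberg u (p.inner j)‖ * ‖heisenberg u (p.outer j)‖ ≤ p.alpha := fun p =>
    Finset.sum_le_sum fun j _ => mul_le_mul (norm_heisenberg_le u _) (norm_heisenberg_le u _)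
      (norm_nonneg _) (norm_nonneg _)
  have hex : ∀ O, expectation (U *ᵥ zeroKet d) O = heisenberg u O 0 0 := expectation_eq u
  have htw : heisenberg u (decP.twist decQ) = ∑ j, heisenberg u (dP.outer j) * heisenberg u Q *
      heisenberg u (dP.inner j) := by
    rw [htwist, map_sum]
    exact Finset.sum_congr rfl fun j _ => by rw [map_mul, map_mul]
  rw [hex, hex, hex, htw]
  refine hmain.trans ?_
  have h1 := mul_le_mul_of_nonneg_left ((hα dP).trans hdPα)
    (mul_nonneg (Nat.cast_nonneg (α := ℝ) kQ) hδ₀)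
  have h2 := mul_le_mul_of_nonneg_left ((hα dQ).trans hdQα)
    (mul_nonneg (Nat.cast_nonneg (α := ℝ) kP) hδ₀)
  linarith

end Lattice

end TwistWitness

end

theorem theorem2 {Λ E : Type*} [Fintype Λ] [DecidableEq Λ] [Fintype E] [DecidableEq E]
    -- the lattice, its extension by the ancillas `E`, and the dimensions of the sites
    (G : SimpleGraph Λ) (G' : SimpleGraph (Λ ⊕ E)) (hG : G'.comap Sum.inl = G)
    (d : Λ ⊕ E → ℕ) [∀ v, NeZero (d v)]
    -- the state, prepared by a depth-`D` nearest-neighbour circuit on the extended lattice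
    (D : ℕ) (U : TwistWitness.Op d) (hU : TwistWitness.IsLocalCircuit G' D U)
    (ψ : TwistWitness.Conf d → ℂ) (hψ : ψ = U *ᵥ TwistWitness.zeroKet d)
    -- two unitaries of depth at most `t`, approximately locally invisible for the lattice state
    (δ : ℝ) (hδ₀ : 0 ≤ δ) (hδ₁ : δ ≤ 1) (r t : ℕ)
    (P Q : TwistWitness.Op (TwistWitness.onLattice d))
    (hP : TwistWitness.IsLocalCircuit G t P) (hQ : TwistWitness.IsLocalCircuit G t Q)
    (hPinv : TwistWitness.IsApproxLocallyInvisible G δ r t (TwistWitness.latticeState ψ) P)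
    (hQinv : TwistWitness.IsApproxLocallyInvisible G δ r t (TwistWitness.latticeState ψ) Q)
    -- their supports meet only in the crossings `X₁` and `X₂`, which the cut `M` separates
    (p q : Set Λ) (hp : TwistWitness.SupportedOn p P) (hq : TwistWitness.SupportedOn q Q)
    (M X₁ X₂ : Set Λ) (hX : p ∩ q ⊆ X₁ ∪ X₂) (hX₁ : X₁ ⊆ M) (hX₂ : X₂ ⊆ Mᶜ)
    -- `kP` discs that cover the `D`-thickening of the support of `P`
    (kP : ℕ) (c : Fin kP → Λ) (rad : Fin kP → ℕ) (hrad : ∀ j, rad j + D ≤ r)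
    (hcover : TwistWitness.thicken G p D ⊆ ⋃ j, TwistWitness.disc G (c j) (rad j))
    (hcΛ : ∀ j, TwistWitness.disc G' (Sum.inl (c j)) (rad j + t + 3 * D) ⊆ Set.range Sum.inl)
    -- discs that cover the `(t + 2D)`-thickenings of the former
    (m : ℕ) (c' : Fin m → Λ) (rad' : Fin m → ℕ) (hrad' : ∀ i, rad' i + D ≤ r)
    (hcover' : (⋃ j, TwistWitness.disc G (c j) (rad j + t + 2 * D)) ⊆
      ⋃ i, TwistWitness.disc G (c' i) (rad' i))
    (hcΛ' : ∀ i, TwistWitness.disc G' (Sum.inl (c' i)) (rad' i + t + 3 * D) ⊆ Set.range Sum.inl)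
    -- each of them meets the support of `Q` only inside `M`, or only outside `M` and at `X₂`
    (hside : ∀ i, TwistWitness.disc G (c' i) (rad' i + D) ∩ q ⊆ M ∨
      (TwistWitness.disc G (c' i) (rad' i + D) ∩ q ⊆ Mᶜ ∧
        (TwistWitness.disc G (c' i) (rad' i + D) ∩ X₂).Nonempty))
    -- the crossing `X₂` is far from the part of the support of `P` beyond the cut
    (dsep : ℕ) (hdsep : ∀ u ∈ p ∩ M, ∀ v ∈ X₂, (dsep : ℕ∞) ≤ G.edist u v)
    (hsep : ∀ i, 2 * (rad' i + t + 3 * D) < dsep)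
    -- at most `kQ` of the discs touch the crossing `X₂`
    (kQ : ℕ)
    (hkQ : {i | (TwistWitness.disc G (c' i) (rad' i + D) ∩ X₂).Nonempty}.ncard ≤ kQ)
    -- decompositions across the cut
    (decP : TwistWitness.CutDecomposition M P) (decQ : TwistWitness.CutDecomposition M Q) :
    ‖TwistWitness.expectation ψ (decP.twist decQ) -
        TwistWitness.expectation ψ P * TwistWitness.expectation ψ Q‖ ≤
      2 * δ * (decP.alpha * kQ + decQ.alpha * kP) := by
  have h := TwistWitness.norm_expectation_twist_sub_le G G' hG d D U hU ψ hψ δ hδ₀ r t P Q hP hQ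
    hPinv hQinv p q hp hq M X₂ kP c rad hrad hcover hcΛ m c' rad' hrad' hcover' hcΛ'
    hside dsep hdsep hsep kQ hkQ decP decQ
  have hα := decP.alpha_nonneg
  have hα' := decQ.alpha_nonneg
  have : 0 ≤ δ * (decP.alpha * kQ + decQ.alpha * kP) := by positivity
  linarith
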